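/- Let $G=(\Lambda,E)$ be a finite undirected graph without self-loops. Give every $e\in E$ an arbitrary direction and call its endpoints $v_{e,0},v_{e,1}$. For $m\in\mathbb N_0$ let $G_m=(\Lambda_m,E_m)$ be the $2^m$-subdivision of $G$: $\Lambda_m$ consists of $\Lambda$ and the new vertices $v_{e,2^{-m}j}$ ($e\in E$, $1\le j\le 2^m-1$), and $E_m$ consists of the edges $\{v_{e,2^{-m}(j-1)},v_{e,2^{-m}j}\}$ ($e\in E$, $1\le j\le 2^m$); thus $\Lambda_m\subseteq\Lambda_{r}$ for $m\le r$. Fix $r\ge 1$. On a probability space with expectation $\mathbb E$, let $W=(W_e)_{e\in E_r}$ be i.i.d. random weights with $W_e>0$ almost surely, regarded as a symmetric $\Lambda_r\times\Lambda_r$ matrix with entry $W_{\{i,j\}}$ if $\{i,j\}\in E_r$ and $0$ otherwise. Given $W$, let $\beta=(\beta_v)_{v\in\Lambda_r}$ have the conditional law $$\nu^W_{\Lambda_r}(d\beta)=\Big(\frac2\pi\Big)^{|\Lambda_r|/2}1_{\{H_\beta>0\}}\frac{e^{-\frac12\langle 1,H_\beta 1\rangle}}{\sqrt{\det H_\beta}}\,d\beta,\qquad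 H_\beta=2\operatorname{diag}(\beta)-W,$$ where $H_\beta>0$ means positive definite and $\langle 1,H_\beta1\rangle$ is the sum of the entries of $H_\beta$. For $0\le m\le r$ put $J=\Lambda_m$, $I=\Lambda_r\setminus\Lambda_m$, and define the effective weights $W^{(m)}=(W^{(m)}_e)_{e\in E_m}$ as the entries at the edges in $E_m$ of the $J\times J$ matrix $$W_{JJ}+W_{JI}\big([H_\beta]_{II}\big)^{-1}W_{IJ}.$$ Set $C_\alpha=2^{-\alpha}\,\Gamma(\tfrac12-\alpha)/\sqrt\pi$ for $0\le\alpha<\tfrac12$ and $c_2=\gamma+\log 2$, with $\gamma$ the Euler–Mascheroni constant. Let $l\in\{1,\dots,r\}$, $\bar e\in E_{l-1}$, $e'\in E_l$. Then $W^{(l-1)}_{\bar e}$ and $W^{(l)}_{e'}$ are almost surely positive, and: 1. $\mathbb E[(W^{(l-1)}_{\bar e})^\alpha]\le 2^{-\alpha}\,\mathbb E[(W^{(l)}_{e'})^\alpha]$ in $[0,\infty]$ for all $\alpha\in[0,1]$. 2. $\mathbb E[(W^{(l-1)}_{\bar e})^\alpha]\le C_\alpha\,\mathbb E[(W^{(l)}_{e'})^\alpha]^2$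 in $[0,\infty]$ for all $\alpha\in[0,\tfrac12)$. 3. If $\mathbb E[\log W^{(l)}_{e'}]$ exists in $[-\infty,\infty]$ (that is, positive and negative part do not both have infinite expectation), then so does $\mathbb E[\log W^{(l-1)}_{\bar e}]$, and $$\mathbb E[\log W^{(l-1)}_{\bar e}]\le\min\big\{\mathbb E[\log W^{(l)}_{e'}]-\log 2,\;2\,\mathbb E[\log W^{(l)}_{e'}]+c_2\big\}.$$ 4. For $\alpha\in[0,\tfrac12)$ with $\mathbb E[(W^{(l)}_{e'})^\alpha]<\infty$, the bound in 1 is strictly smaller than the bound in 2 if and only if $\mathbb E[(W^{(l)}_{e'})^\alpha]>2^{-\alpha}C_\alpha^{-1}$. 5. If $\mathbb E[\log W^{(l)}_{e'}]$ exists and is not $-\infty$, the minimum in 3 equals $\mathbb E[\log W^{(l)}_{e'}]-\log 2$ if and only if $\mathbb E[\log W^{(l)}_{e'}]\ge-\log 2-c_2$. 6. For $m\in\{l-1,l\}$, the expectations $\mathbb E[(W^{(m)}_e)^\alpha]$ ($\alpha\in[0,1]$) and the existence and the value of $\mathbb E[\log W^{(m)}_e]$ do not depend on the choice of $e\in E_m$.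 -/

import Mathlib

open MeasureTheory ProbabilityTheory
open scoped ENNReal

noncomputable section

/-! The random field `β` on a finite set and effective weights -/

section General

variable {Λ : Type*} [Fintype Λ] [DecidableEq Λ]

/-- `H_β = 2 diag(β) - W`. -/
def hMatrix (W : Matrix Λ Λ ℝ) (β : Λ → ℝ) : Matrix Λ Λ ℝ :=
  (2 : ℝ) • Matrix.diagonal β - W

/-- The measure
`(2/π)^{|Λ|/2} 1_{H_β > 0} exp(-⟨1, H_β 1⟩ / 2) / sqrt(det H_β) dβ` on `ℝ^Λ`,
where `⟨1, H_β 1⟩` is the sum of all entries of `H_β`. -/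
def betaLaw (W : Matrix Λ Λ ℝ) : Measure (Λ → ℝ) :=
  volume.withDensity fun β =>
    Set.indicator {b : Λ → ℝ | (hMatrix W b).PosDef}
      (fun b => ENNReal.ofReal
        ((2 / Real.pi) ^ ((Fintype.card Λ : ℝ) / 2)
          * Real.exp (-(1 / 2) * ∑ i, ∑ j, hMatrix W b i j)
          / Real.sqrt (hMatrix W b).det)) β

open Classical in
/-- The effective weights `W^J(β_I) = W_JJ + W_JI ([H_β]_II)⁻¹ W_IJ` on `J`, with `I = Λ \ J`.
They depend on `β` only through `β_I`. -/
def effWeight (W : Matrix Λ Λ ℝ) (J : Set Λ) (β : Λ → ℝ) : Matrix J J ℝ :=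
  W.toBlock (· ∈ J) (· ∈ J)
    + W.toBlock (· ∈ J) (· ∉ J) * ((hMatrix W β).toBlock (· ∉ J) (· ∉ J))⁻¹
      * W.toBlock (· ∉ J) (· ∈ J)

end General

/-! Subdivided graphs -/

section Subdivision

variable {V : Type*}

/-- Vertices of the `2^r`-subdivision of `G`: the vertices of `G`, and for each edge `e` the
`2^r - 1` new vertices `v_{e, k/2^r}`, `0 < k < 2^r`, represented by `(e, k)`. -/
abbrev SubdivVertex (G : SimpleGraph V) (r : ℕ) : Type _ :=
  V ⊕ (G.edgeSet × {k : ℕ // k ∈ Finset.Ioo 0 (2 ^ r)})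

/-- Edges of the `2^r`-subdivision of `G`: each edge `e` of `G` is replaced by a series of `2^r`
edges; `(e, j)` with `0 ≤ j < 2^r` is the edge joining `v_{e, j/2^r}` and `v_{e, (j+1)/2^r}`. -/
abbrev SubdivEdge (G : SimpleGraph V) (r : ℕ) : Type _ :=
  G.edgeSet × Fin (2 ^ r)

variable {G : SimpleGraph V}

/-- The point `v_{e, k/2^r}` for `0 ≤ k ≤ 2^r`; for `k = 0` and `k = 2^r` it is the first and the
second endpoint of `e` with respect to the chosen direction of `e`. -/
def subdivPoint (dir : G.edgeSet → G.Dart) (r : ℕ) (e : G.edgeSet) (k : ℕ) : SubdivVertex G r :=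
  if h : k ∈ Finset.Ioo 0 (2 ^ r) then Sum.inr (e, ⟨k, h⟩)
  else if k = 0 then Sum.inl (dir e).fst else Sum.inl (dir e).snd

/-- The two ends of an edge of the subdivided graph. -/
def subdivEnds (dir : G.edgeSet → G.Dart) (r : ℕ) (a : SubdivEdge G r) : Sym2 (SubdivVertex G r) :=
  s(subdivPoint dir r a.1 a.2, subdivPoint dir r a.1 (a.2 + 1))

/-- The inclusion of the vertex set `Λ_l` of the `2^l`-subdivision into `Λ_r`, for `l ≤ r`,
identifying `v_{e, k/2^l}` with `v_{e, k 2^{r-l}/2^r}`. -/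
def subdivIncl {l r : ℕ} (h : l ≤ r) : SubdivVertex G l → SubdivVertex G r :=
  Sum.map id (Prod.map id fun k => ⟨k.1 * 2 ^ (r - l), by
    have hk := Finset.mem_Ioo.mp k.2
    refine Finset.mem_Ioo.mpr ⟨Nat.mul_pos hk.1 (by positivity), ?_⟩
    calc k.1 * 2 ^ (r - l) < 2 ^ l * 2 ^ (r - l) :=
          Nat.mul_lt_mul_of_pos_right hk.2 (by positivity)
      _ = 2 ^ r := by rw [← pow_add, Nat.add_sub_cancel' h]⟩)

variable [Fintype V] [DecidableEq V] [DecidableRel G.Adj]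

/-- The symmetric weight matrix on `Λ_r` with entry `w_a` at the two ends of an edge `a`, and
zero for all other pairs of vertices. -/
def weightMatrix (dir : G.edgeSet → G.Dart) (r : ℕ) (w : SubdivEdge G r → ℝ) :
    Matrix (SubdivVertex G r) (SubdivVertex G r) ℝ :=
  fun x y => ∑ a : SubdivEdge G r, if subdivEnds dir r a = s(x, y) then w a else 0

/-- The effective weights `W^{(l)} = W^{Λ_l}(β)` on the edges of the `2^l`-subdivision, for edge
weights `w` and a field `β` on the `2^r`-subdivision, `l ≤ r`. -/
def effEdgeWeight (dir : G.edgeSet → G.Dart) {l r : ℕ} (h : l ≤ r)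
    (w : SubdivEdge G r → ℝ) (β : SubdivVertex G r → ℝ) (a : SubdivEdge G l) : ℝ :=
  effWeight (weightMatrix dir r w) (Set.range (subdivIncl (G := G) h)) β
    ⟨subdivIncl h (subdivPoint dir l a.1 a.2), Set.mem_range_self _⟩
    ⟨subdivIncl h (subdivPoint dir l a.1 (a.2 + 1)), Set.mem_range_self _⟩

end Subdivision

/-! Conditional laws and expectations -/

section Probability

variable {Ω : Type*} [MeasurableSpace Ω]

/-- `κ (X ω)` is a version of the conditional law of `Y` given `X`. -/
def IsCondLaw {S T : Type*} [MeasurableSpace S] [MeasurableSpace T] (P : Measure Ω)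
    (Y : Ω → T) (X : Ω → S) (κ : S → Measure T) : Prop :=
  ∀ A : Set S, MeasurableSet A → ∀ B : Set T, MeasurableSet B →
    P (X ⁻¹' A ∩ Y ⁻¹' B) = ∫⁻ ω in X ⁻¹' A, κ (X ω) B ∂P

/-- The expectation in `[0, ∞]` of a nonnegative random variable. -/
def posExp (P : Measure Ω) (X : Ω → ℝ) : ℝ≥0∞ :=
  ∫⁻ ω, ENNReal.ofReal (X ω) ∂P

/-- The expectation of `X` exists in `[-∞, ∞]`: positive and negative part do not both have
infinite expectation. -/
def HasExtExp (P : Measure Ω) (X : Ω → ℝ) : Prop :=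
  posExp P X ≠ ∞ ∨ posExp P (fun ω => -X ω) ≠ ∞

/-- The expectation `E[X⁺] - E[X⁻]` in `[-∞, ∞]`, meaningful under `HasExtExp P X`. -/
def extExp (P : Measure Ω) (X : Ω → ℝ) : EReal :=
  (posExp P X : EReal) - (posExp P (fun ω => -X ω) : EReal)

end Probability

/-- `C_α = 2^{-α} Γ(1/2 - α) / √π`. -/
def cAlpha (α : ℝ) : ℝ := 2 ^ (-α) * Real.Gamma (1 / 2 - α) / Real.sqrt Real.pi

/-- `c₂ = γ + log 2`, with the Euler–Mascheroni constant `γ`. -/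
def cTwo : ℝ := Real.eulerMascheroniConstant + Real.log 2

end

/-!
The `2^l`-subdivision arises from the `2^(l-1)`-subdivision by inserting the midpoint of each edge,
so the passage from `W^(l)` to `W^(l-1)` eliminates midpoints. These are pairwise non-adjacent, and
the corresponding block of `H_β` is diagonal. Eliminating them replaces two edges in series with
weights `t₁`, `t₂` by one edge of weight `t₁ t₂ / s`, where `s = 2 β` at the midpoint is the pivot,
and translates the field on the remaining vertices
(`hMatrix_reducedMatrix_weightMatrix`).

The density of the field factorizes accordingly (`betaDensity_fromBlocks`): given the weights, the
pivots are independent with the reciprocal inverse Gaussian law `pivotDensity (t₁ + t₂)`, and the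
translated field on the remaining vertices has the density that belongs to the reduced weights.
Hence one step of the reduction sends independent weights and their field to independent weights
and their field (`map_fieldLaw_succ`). The same factorization, applied to one vertex at a time,
shows that `betaLaw` is a probability measure (`lintegral_betaDensity`). Since inverting `H_β`
turns Schur complements into restrictions, the effective weights on level `l`, which are defined by
eliminating all of `Λ_r \ Λ_l` at once, agree with those produced by the successive steps
(`effWeight_range`, `exists_reduced_field`). So the weights on level `l` have a common law `ν`, and
each weight on level `l - 1` is distributed as `t₁ t₂ / s` with `t₁`, `t₂` independent with law `ν`
and `s` a pivot with parameter `η = t₁ + t₂` (`exists_pivot_data`).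

The bounds are now statements about three real random variables. In the coordinate `√s - η / √s`
the law of `s` becomes a half Gaussian by the Cauchy–Schlömilch substitution; hence `η / s` has
mean one. The law of `s` is stochastically increasing in `η`, so `E[s ^ (-α)]` is at most its value
`C_α` at `η = 0`.

* Writing `t₁ t₂ / s` as `t₁ t₂ / η` times `η / s`, Bernoulli's inequality and the comparison of
  harmonic and geometric mean give the first moment bound (`posExp_combineSeries_rpow_le`).
* Independence of `t₁` and `t₂` and the bound on `E[s ^ (-α)]` give the second one
  (`posExp_combineSeries_rpow_le_sq`).
* The first logarithmic bound is obtained in the same way as the first moment bound, from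
  `log x ≤ x - 1`. For the second one, `-log s ≤ (s ^ (-α) - 1) / α`, and `(C_α - 1) / α` tends to
  `C'_0 = γ + log 2 = c₂` as `α → 0`. When the positive or the negative part of `log t₁` is not
  integrable, comparisons of `log (t₁ t₂ / s)` with `log t₁` and `log t₂` settle both the existence
  and the value of the expectation (`extExp_log_combineSeries_le`).
-/

noncomputable section

/-! ### Block elimination for the density of the random field -/

section BlockElimination

variable {I J Λ Λ' : Type*} [Fintype I] [Fintype J] [Fintype Λ] [Fintype Λ']
  [DecidableEq I] [DecidableEq J] [DecidableEq Λ] [DecidableEq Λ']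

/-- The Lebesgue density of `betaLaw W` at `β`, as a function of the matrix `H = H_β`. -/
def betaDensity (H : Matrix Λ Λ ℝ) : ℝ≥0∞ :=
  Set.indicator {H : Matrix Λ Λ ℝ | H.PosDef}
    (fun H => ENNReal.ofReal
      ((2 / Real.pi) ^ ((Fintype.card Λ : ℝ) / 2)
        * Real.exp (-(1 / 2) * ∑ i, ∑ j, H i j) / Real.sqrt H.det)) H

theorem betaLaw_eq_withDensity (W : Matrix Λ Λ ℝ) :
    betaLaw W = volume.withDensity fun β => betaDensity (hMatrix W β) := by
  unfold betaLaw betaDensity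
  congr 1

theorem betaDensity_of_not_posDef {H : Matrix Λ Λ ℝ} (h : ¬ H.PosDef) : betaDensity H = 0 :=
  Set.indicator_of_notMem (by simpa using h) _

theorem betaDensity_of_posDef {H : Matrix Λ Λ ℝ} (h : H.PosDef) :
    betaDensity H = ENNReal.ofReal
      ((2 / Real.pi) ^ ((Fintype.card Λ : ℝ) / 2)
        * Real.exp (-(1 / 2) * ∑ i, ∑ j, H i j) / Real.sqrt H.det) :=
  Set.indicator_of_mem (by simpa using h) _

theorem betaDensity_submatrix_equiv (H : Matrix Λ Λ ℝ) (e : Λ' ≃ Λ) :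
    betaDensity (H.submatrix e e) = betaDensity H := by
  by_cases h : H.PosDef
  · have h' : (H.submatrix e e).PosDef := h.submatrix e.injective
    rw [betaDensity_of_posDef h, betaDensity_of_posDef h', Matrix.det_submatrix_equiv_self,
      Fintype.card_congr e]
    have : ∑ i, ∑ j, H.submatrix e e i j = ∑ i, ∑ j, H i j := by
      rw [← Equiv.sum_comp e (fun i => ∑ j, H i j)]
      refine Finset.sum_congr rfl fun i _ => ?_
      rw [← Equiv.sum_comp e (fun j => H (e i) j)]
      rfl
    rw [this]
  · have h' : ¬ (H.submatrix e e).PosDef := fun h2 => h <| by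
      simpa using h2.submatrix e.symm.injective
    rw [betaDensity_of_not_posDef h, betaDensity_of_not_posDef h']

/-- The conditional density of `s = H_{vv}` when a vertex `v` is eliminated: the reciprocal inverse
Gaussian density in the variable `s`, written with respect to `s / 2`, which is the scale on which
the field `β` lives. The parameter `η` is the total weight of the edges at `v`. -/
def pivotDensity (η s : ℝ) : ℝ≥0∞ :=
  if 0 < s then ENNReal.ofReal
    ((2 / Real.pi) ^ ((1 : ℝ) / 2) * Real.exp (-(1 / 2) * (s + η ^ 2 / s - 2 * η)) / Real.sqrt s)
  else 0

theorem posDef_fromBlocks_iff {A : Matrix I I ℝ} (B : Matrix I J ℝ) (C : Matrix J J ℝ)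
    (hA : A.PosDef) :
    (Matrix.fromBlocks A B B.transpose C).PosDef ↔ (C - B.transpose * A⁻¹ * B).PosDef := by
  have : Invertible A := hA.isUnit.invertible
  have hdet : (Matrix.fromBlocks A B B.transpose C).det
      = A.det * (C - B.transpose * A⁻¹ * B).det := by
    rw [Matrix.det_fromBlocks₁₁, Matrix.invOf_eq_nonsing_inv]
  have h1 := Matrix.PosDef.fromBlocks₁₁ B C hA
  rw [Matrix.conjTranspose_eq_transpose_of_trivial] at h1
  have hA' : A.det ≠ 0 := hA.det_pos.ne'
  constructor
  · intro h
    refine (h1.1 h.posSemidef).posDef_iff_det_ne_zero.2 ?_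
    have := h.det_pos.ne'
    rw [hdet] at this
    exact right_ne_zero_of_mul this
  · intro h
    refine (h1.2 h.posSemidef).posDef_iff_det_ne_zero.2 ?_
    rw [hdet]
    exact mul_ne_zero hA' h.det_pos.ne'

/-- The lower right block of the inverse of a positive definite block matrix is the inverse of the
Schur complement. -/
theorem toBlocks₂₂_inv_fromBlocks {A : Matrix I I ℝ} (B : Matrix I J ℝ) (C : Matrix J J ℝ)
    (hA : A.PosDef) (hH : (Matrix.fromBlocks A B B.transpose C).PosDef) :
    (Matrix.fromBlocks A B B.transpose C)⁻¹.toBlocks₂₂ = (C - B.transpose * A⁻¹ * B)⁻¹ := by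
  have hS := (posDef_fromBlocks_iff B C hA).1 hH
  have : Invertible A := hA.isUnit.invertible
  have : Invertible (Matrix.fromBlocks A B B.transpose C) := hH.isUnit.invertible
  have : Invertible (C - B.transpose * ⅟A * B) := by
    rw [Matrix.invOf_eq_nonsing_inv]; exact hS.isUnit.invertible
  rw [← Matrix.invOf_eq_nonsing_inv (Matrix.fromBlocks A B B.transpose C),
    Matrix.invOf_fromBlocks₁₁_eq, Matrix.toBlocks_fromBlocks₂₂, Matrix.invOf_eq_nonsing_inv,
    Matrix.invOf_eq_nonsing_inv]

omit [Fintype J] [DecidableEq J] in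
theorem transpose_mul_diagonal_mul_apply (d : I → ℝ) (B : Matrix I J ℝ) (j j' : J) :
    (B.transpose * Matrix.diagonal d * B) j j' = ∑ i, B i j * d i * B i j' := by
  rw [Matrix.mul_apply]
  simp only [Matrix.mul_diagonal, Matrix.transpose_apply]

theorem inv_diagonal_of_pos {d : I → ℝ} (hd : ∀ i, 0 < d i) :
    (Matrix.diagonal d)⁻¹ = Matrix.diagonal fun i => (d i)⁻¹ := by
  rw [Matrix.inv_eq_right_inv]
  rw [Matrix.diagonal_mul_diagonal, ← Matrix.diagonal_one]
  congr 1
  ext i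
  exact mul_inv_cancel₀ (hd i).ne'

/-- The density of the field factorizes when a set of pairwise non-adjacent vertices, which
corresponds to a diagonal block, is eliminated: the eliminated vertices are independent, and the
remaining ones see the density of the Schur complement. -/
theorem betaDensity_fromBlocks (d : I → ℝ) (B : Matrix I J ℝ) (C : Matrix J J ℝ) :
    betaDensity (Matrix.fromBlocks (Matrix.diagonal d) (-B) (-B).transpose C)
      = (∏ i, pivotDensity (∑ j, B i j) (d i))
        * betaDensity (C - B.transpose * Matrix.diagonal (fun i => (d i)⁻¹) * B) := by
  by_cases hd : ∀ i, 0 < d i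
  · have hA : (Matrix.diagonal d).PosDef := Matrix.PosDef.diagonal hd
    have hiff := posDef_fromBlocks_iff (-B) C hA
    have hSch : C - (-B).transpose * (Matrix.diagonal d)⁻¹ * (-B)
        = C - B.transpose * Matrix.diagonal (fun i => (d i)⁻¹) * B := by
      rw [inv_diagonal_of_pos hd]
      simp
    rw [hSch] at hiff
    by_cases hS : (C - B.transpose * Matrix.diagonal (fun i => (d i)⁻¹) * B).PosDef
    · rw [betaDensity_of_posDef hS, betaDensity_of_posDef (hiff.2 hS)]
      have hdet : (Matrix.fromBlocks (Matrix.diagonal d) (-B) (-B).transpose C).det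
          = (∏ i, d i) * (C - B.transpose * Matrix.diagonal (fun i => (d i)⁻¹) * B).det := by
        have : Invertible (Matrix.diagonal d) := hA.isUnit.invertible
        rw [Matrix.det_fromBlocks₁₁, Matrix.invOf_eq_nonsing_inv, Matrix.det_diagonal, hSch]
      have hsum : ∑ i, ∑ j, Matrix.fromBlocks (Matrix.diagonal d) (-B) (-B).transpose C i j
          = (∑ i, (d i + (∑ j, B i j) ^ 2 / d i - 2 * ∑ j, B i j))
            + ∑ i, ∑ j, (C - B.transpose * Matrix.diagonal (fun i => (d i)⁻¹) * B) i j := by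
        simp only [Matrix.sub_apply, transpose_mul_diagonal_mul_apply, Fintype.sum_sum_type,
          Matrix.fromBlocks_apply₁₁, Matrix.fromBlocks_apply₁₂, Matrix.fromBlocks_apply₂₁,
          Matrix.fromBlocks_apply₂₂, Matrix.transpose_apply, Matrix.neg_apply,
          Finset.sum_sub_distrib, Finset.sum_add_distrib, Finset.sum_neg_distrib]
        have e1 : ∑ x, ∑ y, Matrix.diagonal d x y = ∑ i, d i := by
          simp [Matrix.diagonal_apply]
        have e2 : ∑ x : J, ∑ y : J, ∑ i, B i x * (d i)⁻¹ * B i y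
            = ∑ i, (∑ j, B i j) ^ 2 / d i := by
          rw [Finset.sum_congr rfl fun x _ => Finset.sum_comm, Finset.sum_comm]
          refine Finset.sum_congr rfl fun i _ => ?_
          rw [sq, Finset.sum_mul_sum, Finset.sum_div]
          refine Finset.sum_congr rfl fun x _ => ?_
          rw [Finset.sum_div]
          refine Finset.sum_congr rfl fun y _ => ?_
          ring
        have e3 : ∑ x : J, ∑ i, B i x = ∑ i, ∑ j, B i j := Finset.sum_comm
        rw [e1, e2, e3, ← Finset.mul_sum]
        ring
      have hprod : ∏ i, pivotDensity (∑ j, B i j) (d i)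
          = ENNReal.ofReal (∏ i, ((2 / Real.pi) ^ ((1 : ℝ) / 2)
            * Real.exp (-(1 / 2) * (d i + (∑ j, B i j) ^ 2 / d i - 2 * ∑ j, B i j))
              / Real.sqrt (d i))) := by
        rw [ENNReal.ofReal_prod_of_nonneg]
        · refine Finset.prod_congr rfl fun i _ => ?_
          rw [pivotDensity, if_pos (hd i)]
        · intro i _
          positivity
      rw [hprod, ← ENNReal.ofReal_mul (Finset.prod_nonneg fun i _ => by positivity), hdet, hsum]
      congr 1
      rw [Finset.prod_div_distrib, Finset.prod_mul_distrib, ← Real.exp_sum, Finset.prod_const,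
        ← Finset.mul_sum, Real.sqrt_mul (Finset.prod_nonneg fun i _ => (hd i).le),
        mul_add, Real.exp_add, Fintype.card_sum, Nat.cast_add, add_div,
        Real.rpow_add (by positivity), ← Real.rpow_natCast, ← Real.rpow_mul (by positivity),
        Finset.card_univ]
      have : ∏ i, Real.sqrt (d i) = Real.sqrt (∏ i, d i) := by
        rw [Real.sqrt_eq_rpow, ← Real.finsetProd_rpow _ _ fun i _ => (hd i).le]
        refine Finset.prod_congr rfl fun i _ => by rw [Real.sqrt_eq_rpow]
      rw [this]
      have hc : (1 : ℝ) / 2 * (Fintype.card I : ℝ) = (Fintype.card I : ℝ) / 2 := by ring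
      rw [hc]
      ring
    · rw [betaDensity_of_not_posDef hS, betaDensity_of_not_posDef (fun h => hS (hiff.1 h)),
        mul_zero]
  -- a nonpositive diagonal entry makes both sides vanish
  · have hnot : ¬ (Matrix.fromBlocks (Matrix.diagonal d) (-B) (-B).transpose C).PosDef := by
      intro h
      apply hd
      have h2 : (Matrix.diagonal d).PosDef := h.submatrix Sum.inl_injective
      exact Matrix.posDef_diagonal_iff.1 h2
    push Not at hd
    obtain ⟨i, hi⟩ := hd
    rw [betaDensity_of_not_posDef hnot, Finset.prod_eq_zero (Finset.mem_univ i), zero_mul]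
    rw [pivotDensity, if_neg hi.not_gt]

theorem measurable_betaDensity {S : Type*} [MeasurableSpace S] {H : S → Matrix Λ Λ ℝ}
    (hH : ∀ i j, Measurable fun s => H s i j) : Measurable fun s => betaDensity (H s) := by
  have hH' : Measurable fun s => fun i j => H s i j :=
    measurable_pi_lambda _ fun i => measurable_pi_lambda _ fun j => hH i j
  have hdet : Measurable fun s => (H s).det := by
    simp only [Matrix.det_apply]
    refine Finset.measurable_sum _ fun σ _ => ?_
    refine Measurable.const_smul ?_ _
    exact Finset.measurable_prod _ fun i _ => hH _ _
  have hset : MeasurableSet {s | (H s).PosDef} := by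
    -- positive definite matrices are the positive semidefinite ones with nonzero determinant,
    -- and positive semidefinite matrices form a closed set
    have hclosed : IsClosed {M : Λ → Λ → ℝ | (Matrix.of M).PosSemidef} := by
      have : {M : Λ → Λ → ℝ | (Matrix.of M).PosSemidef}
          = {M | ∀ i j, M i j = M j i} ∩ ⋂ x : Λ → ℝ, {M | 0 ≤ ∑ i, x i * ∑ j, M i j * x j} := by
        ext M
        simp only [Set.mem_ofPred_eq, Set.mem_inter_iff, Set.mem_iInter,
          Matrix.posSemidef_iff_dotProduct_mulVec]
        refine and_congr ?_ ?_
        · rw [Matrix.IsHermitian, Matrix.conjTranspose_eq_transpose_of_trivial]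
          constructor
          · intro h i j
            exact (congrFun (congrFun h j) i)
          · intro h
            ext i j
            exact h j i
        · rfl
      rw [this]
      refine IsClosed.inter ?_ (isClosed_iInter fun x => ?_)
      · simp only [Set.ofPred_forall]
        exact isClosed_iInter fun i => isClosed_iInter fun j =>
          isClosed_eq (by fun_prop) (by fun_prop)
      · exact isClosed_le continuous_const (by fun_prop)
    have : {s | (H s).PosDef} = (fun s => fun i j => H s i j) ⁻¹'
        {M : Λ → Λ → ℝ | (Matrix.of M).PosSemidef} ∩ {s | (H s).det ≠ 0} := by
      ext s
      constructor
      · intro h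
        exact ⟨h.posSemidef, h.det_pos.ne'⟩
      · rintro ⟨h1, h2⟩
        exact (Matrix.PosSemidef.posDef_iff_det_ne_zero (A := H s) h1).2 h2
    rw [this]
    exact (hH' hclosed.measurableSet).inter (hdet (measurableSet_singleton 0).compl)
  have : (fun s => betaDensity (H s)) = Set.indicator {s | (H s).PosDef} fun s =>
      ENNReal.ofReal ((2 / Real.pi) ^ ((Fintype.card Λ : ℝ) / 2)
        * Real.exp (-(1 / 2) * ∑ i, ∑ j, H s i j) / Real.sqrt (H s).det) := by
    ext s
    by_cases h : (H s).PosDef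
    · rw [betaDensity_of_posDef h, Set.indicator_of_mem (by simpa using h)]
    · rw [betaDensity_of_not_posDef h, Set.indicator_of_notMem (by simpa using h)]
  rw [this]
  refine Measurable.indicator ?_ hset
  have hs : Measurable fun s => ∑ i, ∑ j, H s i j :=
    Finset.measurable_sum _ fun i _ => Finset.measurable_sum _ fun j _ => hH i j
  fun_prop

theorem measurable_pivotDensity : Measurable fun p : ℝ × ℝ => pivotDensity p.1 p.2 := by
  unfold pivotDensity
  refine Measurable.ite (measurableSet_lt measurable_const measurable_snd) ?_ measurable_const
  fun_prop

end BlockElimination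

/-! ### The law of a single pivot -/

section Pivot

theorem lintegral_Ioi_comp_div {η : ℝ} (hη : 0 < η) (F : ℝ → ℝ≥0∞) :
    ∫⁻ x in Set.Ioi (0 : ℝ), F x
      = ∫⁻ x in Set.Ioi (0 : ℝ), ENNReal.ofReal (η / x ^ 2) * F (η / x) := by
  have himg : (fun x : ℝ => η / x) '' Set.Ioi 0 = Set.Ioi 0 := by
    ext y
    constructor
    · rintro ⟨x, hx, rfl⟩
      exact div_pos hη hx
    · intro hy
      have hy : 0 < y := hy
      exact ⟨η / y, div_pos hη hy, by field_simp⟩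
  have h := lintegral_image_eq_lintegral_abs_deriv_mul (f := fun x : ℝ => η / x)
    (f' := fun x => -(η / x ^ 2)) measurableSet_Ioi (fun x hx => by
      have hx : 0 < x := hx
      have := (hasDerivAt_inv hx.ne').const_mul η
      refine (this.congr_deriv (by field_simp)).hasDerivWithinAt.congr (fun y _ => ?_) ?_ <;>
        exact div_eq_mul_inv _ _) (fun x hx y hy hxy => by
      have hx : 0 < x := hx
      have hy : 0 < y := hy
      have hxy : η / x = η / y := hxy
      field_simp at hxy
      exact hxy.symm) F
  rw [himg] at h
  rw [h]
  refine setLIntegral_congr_fun measurableSet_Ioi fun x hx => ?_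
  have hx : 0 < x := hx
  simp only [abs_neg]
  rw [abs_of_pos (by positivity)]

/-- The reflection `x ↦ η / x` changes the sign of `x - η / x`. -/
theorem lintegral_Ioi_sub_div_mul {η : ℝ} (hη : 0 < η) {f : ℝ → ℝ≥0∞}
    (heven : ∀ x, f (-x) = f x) :
    ∫⁻ x in Set.Ioi (0 : ℝ), f (x - η / x) * ENNReal.ofReal (η / x ^ 2)
      = ∫⁻ x in Set.Ioi (0 : ℝ), f (x - η / x) := by
  rw [lintegral_Ioi_comp_div hη fun x => f (x - η / x)]
  refine setLIntegral_congr_fun measurableSet_Ioi fun x hx => ?_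
  have hx : 0 < x := hx
  have : η / x - η / (η / x) = -(x - η / x) := by field_simp; ring
  simp only [this, heven]
  exact mul_comm _ _

/-- The Cauchy–Schlömilch substitution: `x ↦ x - η / x` preserves Lebesgue integrals of even
functions over the positive half-line. -/
theorem lintegral_Ioi_sub_div {η : ℝ} (hη : 0 ≤ η) {f : ℝ → ℝ≥0∞} (hf : Measurable f)
    (heven : ∀ x, f (-x) = f x) :
    ∫⁻ x in Set.Ioi (0 : ℝ), f (x - η / x) = ∫⁻ y in Set.Ioi (0 : ℝ), f y := by
  rcases hη.eq_or_lt with rfl | hη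
  · simp
  have himg : (fun x : ℝ => x - η / x) '' Set.Ioi 0 = Set.univ := by
    refine Set.eq_univ_of_forall fun y => ?_
    have h1 : |y| < Real.sqrt (y ^ 2 + 4 * η) := by
      rw [← Real.sqrt_sq_eq_abs]
      exact Real.sqrt_lt_sqrt (sq_nonneg y) (by linarith)
    have h2 : Real.sqrt (y ^ 2 + 4 * η) ^ 2 = y ^ 2 + 4 * η := Real.sq_sqrt (by positivity)
    set q := Real.sqrt (y ^ 2 + 4 * η)
    have h3 : 0 < y + q := by linarith [neg_abs_le y]
    refine ⟨(y + q) / 2, by simpa using h3, ?_⟩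
    simp only
    field_simp
    linarith
  have hmono : StrictMonoOn (fun x : ℝ => x - η / x) (Set.Ioi 0) := by
    intro x hx y hy hxy
    have : η / y < η / x := div_lt_div_of_pos_left hη hx hxy
    simp only
    linarith
  have h := lintegral_image_eq_lintegral_abs_deriv_mul (f := fun x : ℝ => x - η / x)
    (f' := fun x => 1 + η / x ^ 2) measurableSet_Ioi (fun x hx => by
      have hx : 0 < x := hx
      have := (hasDerivAt_id x).sub ((hasDerivAt_inv hx.ne').const_mul η)
      refine (this.congr_deriv (by field_simp; ring)).hasDerivWithinAt.congr (fun y _ => ?_) ?_ <;>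
        simp [div_eq_mul_inv]) hmono.injOn f
  rw [himg] at h
  have hsplit : ∫⁻ x in Set.univ, f x = 2 * ∫⁻ y in Set.Ioi (0 : ℝ), f y := by
    have hneg : ∫⁻ y in Set.Iic (0 : ℝ), f y = ∫⁻ y in Set.Ioi (0 : ℝ), f y := by
      have := (Measure.measurePreserving_neg (volume : Measure ℝ)).setLIntegral_comp_preimage
        (measurableSet_Ici (a := (0 : ℝ))) hf
      simp only [heven, Set.neg_preimage, Set.neg_Ici, neg_zero] at this
      rw [this, setLIntegral_congr Ioi_ae_eq_Ici]
    rw [← Set.Iic_union_Ioi (a := (0 : ℝ)), lintegral_union measurableSet_Ioi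
      (Set.Iic_disjoint_Ioi le_rfl), hneg, two_mul]
  -- `1 + η / x ^ 2` is the derivative of `x - η / x`, and both summands contribute the same amount
  have hdouble : ∫⁻ x in Set.Ioi (0 : ℝ), ENNReal.ofReal |1 + η / x ^ 2| * f (x - η / x)
      = 2 * ∫⁻ x in Set.Ioi (0 : ℝ), f (x - η / x) := by
    rw [two_mul]
    nth_rewrite 2 [← lintegral_Ioi_sub_div_mul hη heven]
    rw [← lintegral_add_left (by fun_prop)]
    refine setLIntegral_congr_fun measurableSet_Ioi fun x hx => ?_
    have hx : 0 < x := hx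
    rw [abs_of_pos (by positivity), ENNReal.ofReal_add zero_le_one (by positivity),
      ENNReal.ofReal_one]
    ring
  rw [hsplit, hdouble] at h
  exact ((ENNReal.mul_right_inj two_ne_zero ENNReal.ofNat_ne_top).1 h).symm

/-- The density of the absolute value of a standard Gaussian variable on the positive half-line. -/
def halfGaussianDensity (y : ℝ) : ℝ≥0∞ :=
  ENNReal.ofReal ((2 / Real.pi) ^ ((1 : ℝ) / 2) * Real.exp (-(1 / 2) * y ^ 2))

theorem measurable_halfGaussianDensity : Measurable halfGaussianDensity := by
  unfold halfGaussianDensity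
  fun_prop

theorem halfGaussianDensity_neg (y : ℝ) : halfGaussianDensity (-y) = halfGaussianDensity y := by
  simp [halfGaussianDensity]

theorem cAlpha_pos {α : ℝ} (hα : α < 1 / 2) : 0 < cAlpha α := by
  have := Real.Gamma_pos_of_pos (s := 1 / 2 - α) (by linarith)
  have := Real.pi_pos
  unfold cAlpha
  positivity

theorem lintegral_halfGaussianDensity_mul_rpow {α : ℝ} (hα : α < 1 / 2) :
    ∫⁻ y in Set.Ioi (0 : ℝ), halfGaussianDensity y * ENNReal.ofReal (y ^ (-(2 * α)))
      = ENNReal.ofReal (cAlpha α) := by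
  have hint := integral_rpow_mul_exp_neg_mul_rpow (p := 2) (q := -(2 * α)) (b := 1 / 2)
    two_pos (by linarith) (by norm_num)
  have hI : ∫ x in Set.Ioi (0 : ℝ), x ^ (-(2 * α)) * Real.exp (-(1 / 2) * x ^ (2 : ℝ))
      = 2 ^ (-α) * Real.Gamma (1 / 2 - α) / Real.sqrt 2 := by
    rw [hint]
    have e1 : ((-(2 * α) + 1) / 2 : ℝ) = 1 / 2 - α := by ring
    have e2 : (-(-(2 * α) + 1) / 2 : ℝ) = α - 1 / 2 := by ring
    rw [e1, e2, Real.rpow_sub (by norm_num : (0 : ℝ) < 1 / 2), ← Real.sqrt_eq_rpow,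
      one_div (2 : ℝ), Real.inv_rpow (by norm_num), ← Real.rpow_neg (by norm_num), Real.sqrt_inv]
    have : Real.sqrt 2 ^ 2 = 2 := Real.sq_sqrt (by norm_num)
    field_simp
    rw [this]
  have hpos : 0 < 2 ^ (-α) * Real.Gamma (1 / 2 - α) / Real.sqrt 2 := by
    have := Real.Gamma_pos_of_pos (s := 1 / 2 - α) (by linarith)
    positivity
  have hintble : Integrable (fun x : ℝ => x ^ (-(2 * α)) * Real.exp (-(1 / 2) * x ^ (2 : ℝ)))
      (volume.restrict (Set.Ioi 0)) := by
    by_contra hcon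
    rw [integral_undef hcon] at hI
    exact hpos.ne hI
  have hc : cAlpha α = (2 / Real.pi) ^ ((1 : ℝ) / 2)
      * (2 ^ (-α) * Real.Gamma (1 / 2 - α) / Real.sqrt 2) := by
    unfold cAlpha
    rw [← Real.sqrt_eq_rpow, Real.sqrt_div (by norm_num)]
    have := Real.pi_pos
    field_simp
  rw [hc, ← hI, ← integral_const_mul, ofReal_integral_eq_lintegral_ofReal (hintble.const_mul _)]
  · refine setLIntegral_congr_fun measurableSet_Ioi fun x hx => ?_
    have hx : 0 < x := hx
    simp only [halfGaussianDensity]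
    rw [← ENNReal.ofReal_mul (by positivity), Real.rpow_two]
    congr 1
    ring
  · refine (ae_restrict_iff' measurableSet_Ioi).2 (Filter.Eventually.of_forall fun x hx => ?_)
    have hx : 0 < x := hx
    have := Real.pi_pos
    simp only [Pi.zero_apply]
    positivity

theorem cAlpha_zero : cAlpha 0 = 1 := by
  have h := Real.Gamma_one_half_eq
  have : Real.sqrt Real.pi ≠ 0 := (Real.sqrt_pos.2 Real.pi_pos).ne'
  unfold cAlpha
  simp only [neg_zero, Real.rpow_zero, sub_zero, one_mul]
  rw [h, div_self this]

theorem cAlpha_neg_one : cAlpha (-1) = 1 := by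
  have h := Real.Gamma_one_half_eq
  have : Real.sqrt Real.pi ≠ 0 := (Real.sqrt_pos.2 Real.pi_pos).ne'
  unfold cAlpha
  rw [neg_neg, Real.rpow_one, show (1 / 2 - -1 : ℝ) = 1 / 2 + 1 by norm_num,
    Real.Gamma_add_one (by norm_num), h]
  field_simp

/-- In the variable `x = √s`, the law of the pivot `s` has the density
`halfGaussianDensity (x - η / x)`. -/
theorem lintegral_pivotDensity_mul (η : ℝ) (g : ℝ → ℝ≥0∞) :
    ∫⁻ b, pivotDensity η (2 * b) * g (2 * b)
      = ∫⁻ x in Set.Ioi (0 : ℝ), halfGaussianDensity (x - η / x) * g (x ^ 2) := by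
  have h0 : ∫⁻ b, pivotDensity η (2 * b) * g (2 * b)
      = ∫⁻ b in Set.Ioi (0 : ℝ), pivotDensity η (2 * b) * g (2 * b) := by
    rw [setLIntegral_eq_of_support_subset]
    intro b hb
    by_contra hb0
    apply hb
    have : ¬ 0 < 2 * b := fun h => hb0 (by simpa using h)
    simp [pivotDensity, this]
  have himg : (fun x : ℝ => x ^ 2 / 2) '' Set.Ioi 0 = Set.Ioi 0 := by
    ext y
    constructor
    · rintro ⟨x, hx, rfl⟩
      have hx : 0 < x := hx
      exact Set.mem_Ioi.2 (by positivity)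
    · intro hy
      have hy : 0 < y := hy
      refine ⟨Real.sqrt (2 * y), Real.sqrt_pos.2 (by positivity), ?_⟩
      simp only
      rw [Real.sq_sqrt (by positivity)]
      ring
  have h := lintegral_image_eq_lintegral_abs_deriv_mul (f := fun x : ℝ => x ^ 2 / 2)
    (f' := fun x => x) measurableSet_Ioi (fun x hx => by
      have := (hasDerivAt_pow 2 x).div_const 2
      exact (this.congr_deriv (by simp)).hasDerivWithinAt) (fun x hx y hy hxy => by
      have hx : 0 < x := hx
      have hy : 0 < y := hy
      have hxy : x ^ 2 / 2 = y ^ 2 / 2 := hxy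
      exact (pow_left_inj₀ hx.le hy.le two_ne_zero).1 (by linarith))
    (fun b => pivotDensity η (2 * b) * g (2 * b))
  rw [himg] at h
  rw [h0, h]
  refine setLIntegral_congr_fun measurableSet_Ioi fun x hx => ?_
  have hx : 0 < x := hx
  have hpos : 0 < x ^ 2 := by positivity
  simp only [mul_div_cancel₀ (x ^ 2) (two_ne_zero' ℝ), pivotDensity, if_pos hpos,
    halfGaussianDensity]
  rw [← mul_assoc, ← ENNReal.ofReal_mul (abs_nonneg x), abs_of_pos hx, Real.sqrt_sq hx.le]
  congr 2
  have : (x - η / x) ^ 2 = x ^ 2 + η ^ 2 / x ^ 2 - 2 * η := by field_simp; ring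
  rw [this]
  field_simp

theorem lintegral_pivotDensity {η : ℝ} (hη : 0 ≤ η) : ∫⁻ b, pivotDensity η (2 * b) = 1 := by
  have h := lintegral_pivotDensity_mul η fun _ => 1
  simp only [mul_one] at h
  rw [h, lintegral_Ioi_sub_div hη measurable_halfGaussianDensity halfGaussianDensity_neg]
  have h1 := lintegral_halfGaussianDensity_mul_rpow (α := 0) (by norm_num)
  simpa [cAlpha_zero] using h1

/-- The reciprocal of the pivot has mean `1 / η`. -/
theorem lintegral_pivotDensity_mul_div {η : ℝ} (hη : 0 < η) :
    ∫⁻ b, pivotDensity η (2 * b) * ENNReal.ofReal (η / (2 * b)) = 1 := by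
  rw [lintegral_pivotDensity_mul η fun s => ENNReal.ofReal (η / s),
    lintegral_Ioi_sub_div_mul hη halfGaussianDensity_neg, ← lintegral_pivotDensity hη.le]
  have h := lintegral_pivotDensity_mul η fun _ => 1
  simp only [mul_one] at h
  exact h.symm

/-- The variable `√s - η / √s` has unit second moment. -/
theorem lintegral_pivotDensity_mul_sq {η : ℝ} (hη : 0 ≤ η) :
    ∫⁻ b, pivotDensity η (2 * b) * ENNReal.ofReal (2 * b + η ^ 2 / (2 * b) - 2 * η) = 1 := by
  rw [lintegral_pivotDensity_mul η fun s => ENNReal.ofReal (s + η ^ 2 / s - 2 * η)]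
  have h1 := lintegral_halfGaussianDensity_mul_rpow (α := -1) (by norm_num)
  rw [cAlpha_neg_one, ENNReal.ofReal_one] at h1
  have h2 := lintegral_Ioi_sub_div hη
    (f := fun y => halfGaussianDensity y * ENNReal.ofReal (y ^ 2))
    (measurable_halfGaussianDensity.mul (by fun_prop))
    (fun y => by simp only [halfGaussianDensity_neg, neg_sq])
  have h3 : ∫⁻ y in Set.Ioi (0 : ℝ), halfGaussianDensity y * ENNReal.ofReal (y ^ 2) = 1 := by
    rw [← h1]
    refine lintegral_congr fun y => ?_
    rw [show -(2 * -1 : ℝ) = (2 : ℕ) by norm_num, Real.rpow_natCast]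
  rw [← h3, ← h2]
  refine setLIntegral_congr_fun measurableSet_Ioi fun x hx => ?_
  have hx : 0 < x := hx
  congr 2
  field_simp
  ring

theorem pivotDensity_eq_zero_mul (η s : ℝ) :
    pivotDensity η s = pivotDensity 0 s * ENNReal.ofReal (Real.exp (η - η ^ 2 / (2 * s))) := by
  unfold pivotDensity
  split_ifs with hs
  · have := Real.pi_pos
    rw [← ENNReal.ofReal_mul (by positivity)]
    congr 1
    rw [div_mul_eq_mul_div, mul_assoc, ← Real.exp_add]
    congr 3
    field_simp
    ring
  · simp

/-- The pivot is stochastically increasing in `η`: negative moments are largest for `η = 0`, where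
the pivot has a chi-squared law. The density ratio with respect to `η = 0` increases in `s` and
passes through `1` at `s = η / 2`, so it is negatively correlated with the decreasing function
`s ↦ s ^ (-α)`. -/
theorem lintegral_pivotDensity_mul_rpow_le {η α : ℝ} (hη : 0 < η) (hα0 : 0 ≤ α)
    (hα : α < 1 / 2) :
    ∫⁻ b, pivotDensity η (2 * b) * ENNReal.ofReal ((2 * b) ^ (-α))
      ≤ ENNReal.ofReal (cAlpha α) := by
  have hzero : ∫⁻ b, pivotDensity 0 (2 * b) * ENNReal.ofReal ((2 * b) ^ (-α))
      = ENNReal.ofReal (cAlpha α) := by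
    rw [lintegral_pivotDensity_mul 0 fun s => ENNReal.ofReal (s ^ (-α)),
      ← lintegral_halfGaussianDensity_mul_rpow hα]
    refine setLIntegral_congr_fun measurableSet_Ioi fun x hx => ?_
    have hx : 0 < x := hx
    simp only [zero_div, sub_zero]
    rw [← Real.rpow_natCast, ← Real.rpow_mul hx.le]
    congr 3
    push_cast
    ring
  have hmeas : ∀ η : ℝ, Measurable fun b : ℝ => pivotDensity η (2 * b) := fun η =>
    measurable_pivotDensity.comp (measurable_const.prodMk (by fun_prop))
  set c : ℝ≥0∞ := ENNReal.ofReal ((η / 2) ^ (-α))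
  -- in the form `g h + c ≤ g + c h` with `g = s ^ (-α)` and `h` the density ratio, no integrability
  -- has to be known beforehand
  have key : ∫⁻ b, (pivotDensity η (2 * b) * ENNReal.ofReal ((2 * b) ^ (-α))
        + pivotDensity 0 (2 * b) * c)
      ≤ ∫⁻ b, (pivotDensity 0 (2 * b) * ENNReal.ofReal ((2 * b) ^ (-α))
        + pivotDensity η (2 * b) * c) := by
    refine lintegral_mono fun b => ?_
    simp only
    by_cases hb : 0 < 2 * b
    · rw [pivotDensity_eq_zero_mul η, mul_assoc, mul_assoc, ← mul_add, ← mul_add]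
      refine mul_le_mul_right ?_ _
      rw [← ENNReal.ofReal_mul (Real.exp_pos _).le, ← ENNReal.ofReal_mul (Real.exp_pos _).le,
        ← ENNReal.ofReal_add (by positivity) (by positivity),
        ← ENNReal.ofReal_add (by positivity) (by positivity)]
      refine ENNReal.ofReal_le_ofReal ?_
      set s := 2 * b
      rcases le_total s (η / 2) with h | h
      · have h1 : Real.exp (η - η ^ 2 / (2 * s)) ≤ 1 := by
          rw [Real.exp_le_one_iff]
          rw [sub_nonpos, le_div_iff₀ (by positivity)]
          nlinarith
        have h2 : (η / 2) ^ (-α) ≤ s ^ (-α) :=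
          Real.rpow_le_rpow_of_nonpos hb h (by linarith)
        nlinarith
      · have h1 : 1 ≤ Real.exp (η - η ^ 2 / (2 * s)) := by
          rw [Real.one_le_exp_iff, sub_nonneg, div_le_iff₀ (by positivity)]
          nlinarith
        have h2 : s ^ (-α) ≤ (η / 2) ^ (-α) :=
          Real.rpow_le_rpow_of_nonpos (by positivity) h (by linarith)
        nlinarith
    · simp [pivotDensity, hb]
  rw [lintegral_add_right _ ((hmeas 0).mul_const c), lintegral_add_right _ ((hmeas η).mul_const c),
    lintegral_mul_const _ (hmeas 0), lintegral_mul_const _ (hmeas η), lintegral_pivotDensity le_rfl,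
    lintegral_pivotDensity hη.le, one_mul, hzero] at key
  exact (ENNReal.add_le_add_iff_right ENNReal.ofReal_ne_top).1 key

end Pivot

/-! ### Product measures -/

section ProductMeasures

variable {I J Λ : Type*} [Fintype I] [Fintype J] [Fintype Λ]

theorem measurePreserving_sumElim_comp {X : Type*} [MeasurableSpace X] (μ : Measure X)
    [SigmaFinite μ] (e : I ⊕ J ≃ Λ) :
    MeasurePreserving (fun p : (I → X) × (J → X) => fun x => Sum.elim p.1 p.2 (e.symm x))
      ((Measure.pi fun _ => μ).prod (Measure.pi fun _ => μ)) (Measure.pi fun _ => μ) := by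
  have h1 := measurePreserving_sumPiEquivProdPi_symm (X := fun _ : I ⊕ J => X) fun _ => μ
  have h2 := measurePreserving_piCongrLeft (α := fun _ : Λ => X) (fun _ => μ) e
  have h3 := h2.comp h1
  convert h3 using 1
  ext p x
  obtain ⟨y, rfl⟩ := e.surjective x
  simp only [Equiv.symm_apply_apply, Function.comp_apply, MeasurableEquiv.coe_piCongrLeft,
    Equiv.piCongrLeft_apply_apply]
  cases y <;> rfl

theorem lintegral_fin_pi_prod {X : Type*} [MeasurableSpace X] (n : ℕ) (μ : Measure X)
    [SigmaFinite μ] (f : Fin n → X → ℝ≥0∞) (hf : ∀ i, Measurable (f i)) :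
    ∫⁻ x, ∏ i, f i (x i) ∂(Measure.pi fun _ : Fin n => μ) = ∏ i, ∫⁻ x, f i x ∂μ := by
  induction n with
  | zero => simp
  | succ n ih =>
    have hm := (measurePreserving_piFinSuccAbove (fun _ : Fin (n + 1) => μ) 0).symm
    have hmeas : Measurable fun x : Fin (n + 1) → X => ∏ i, f i (x i) :=
      Finset.measurable_prod _ fun i _ => (hf i).comp (measurable_pi_apply i)
    rw [← hm.lintegral_comp hmeas]
    simp only [MeasurableEquiv.piFinSuccAbove_symm_apply, Fin.insertNthEquiv,
      Fin.prod_univ_succ, Fin.insertNth_zero, Equiv.coe_fn_mk, Fin.cons_succ, Fin.cons_zero,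
      Fin.zero_succAbove, cast_eq]
    have hmul := lintegral_prod_mul (μ := μ) (ν := Measure.pi fun _ : Fin n => μ)
      (f := f 0) (g := fun y => ∏ i : Fin n, f i.succ (y i)) (hf 0).aemeasurable
      (Finset.measurable_prod _ fun i _ => (hf _).comp (measurable_pi_apply i)).aemeasurable
    rw [ih (fun i => f i.succ) fun i => hf _] at hmul
    exact hmul

theorem lintegral_pi_prod {X : Type*} [MeasurableSpace X] (μ : Measure X)
    [SigmaFinite μ] (f : I → X → ℝ≥0∞) (hf : ∀ i, Measurable (f i)) :
    ∫⁻ x, ∏ i, f i (x i) ∂(Measure.pi fun _ : I => μ) = ∏ i, ∫⁻ x, f i x ∂μ := by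
  have e := (Fintype.equivFin I).symm
  have h2 := measurePreserving_piCongrLeft (α := fun _ : I => X) (fun _ => μ) e
  have hmeas : Measurable fun x : I → X => ∏ i, f i (x i) :=
    Finset.measurable_prod _ fun i _ => (hf i).comp (measurable_pi_apply i)
  rw [← h2.lintegral_comp hmeas, ← e.prod_comp]
  simp_rw [← e.prod_comp, MeasurableEquiv.coe_piCongrLeft, Equiv.piCongrLeft_apply_apply]
  exact lintegral_fin_pi_prod _ μ (fun i => f (e i)) fun i => hf _

theorem pi_withDensity {X : Type*} [MeasurableSpace X] (μ : Measure X) [SigmaFinite μ]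
    (f : X → ℝ≥0∞) (hf : Measurable f) [SigmaFinite (μ.withDensity f)] :
    (Measure.pi fun _ : I => μ.withDensity f)
      = (Measure.pi fun _ : I => μ).withDensity fun x => ∏ i, f (x i) := by
  refine (Measure.pi_eq fun s hs => ?_)
  rw [withDensity_apply _ (MeasurableSet.univ_pi hs), ← lintegral_indicator (.univ_pi hs)]
  have : ((Set.univ.pi s).indicator fun x : I → X => ∏ i, f (x i))
      = fun x => ∏ i, (s i).indicator f (x i) := by
    ext x
    by_cases hx : x ∈ Set.univ.pi s
    · rw [Set.indicator_of_mem hx]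
      exact Finset.prod_congr rfl fun i _ => (Set.indicator_of_mem (hx i trivial) _).symm
    · rw [Set.indicator_of_notMem hx]
      obtain ⟨i, hi⟩ : ∃ i, x i ∉ s i := by simpa [Set.mem_pi] using hx
      exact (Finset.prod_eq_zero (Finset.mem_univ i) (Set.indicator_of_notMem hi _)).symm
  rw [this, lintegral_pi_prod μ (fun i => (s i).indicator f) fun i => hf.indicator (hs i)]
  refine Finset.prod_congr rfl fun i _ => ?_
  rw [lintegral_indicator (hs i), withDensity_apply _ (hs i)]

end ProductMeasures

/-! ### Elimination of pairwise non-adjacent vertices -/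

section Elimination

variable {I J Λ : Type*} [Fintype I] [Fintype J] [Fintype Λ]
  [DecidableEq I] [DecidableEq J] [DecidableEq Λ]

/-- The effective weight matrix on `J` after eliminating the pairwise non-adjacent vertices of `I`,
where `e` identifies the vertex set with `I ⊕ J` and `b` is the field on `I`. -/
def reducedMatrix (W : Matrix Λ Λ ℝ) (e : I ⊕ J ≃ Λ) (b : I → ℝ) : Matrix J J ℝ := fun j j' =>
  W (e (.inr j)) (e (.inr j'))
    + ∑ i, W (e (.inl i)) (e (.inr j)) * (2 * b i - W (e (.inl i)) (e (.inl i)))⁻¹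
      * W (e (.inl i)) (e (.inr j'))

omit [Fintype Λ] in
theorem hMatrix_apply (W : Matrix Λ Λ ℝ) (β : Λ → ℝ) (x y : Λ) :
    hMatrix W β x y = (if x = y then 2 * β x else 0) - W x y := by
  simp [hMatrix, Matrix.diagonal_apply]

omit [Fintype I] [Fintype J] [Fintype Λ] in
theorem hMatrix_submatrix_eq_fromBlocks (W : Matrix Λ Λ ℝ) (hW : W.IsSymm) (e : I ⊕ J ≃ Λ)
    (h0 : ∀ i i', i ≠ i' → W (e (.inl i)) (e (.inl i')) = 0) (β : Λ → ℝ) :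
    (hMatrix W β).submatrix e e
      = Matrix.fromBlocks
          (Matrix.diagonal fun i => 2 * β (e (.inl i)) - W (e (.inl i)) (e (.inl i)))
          (-Matrix.of fun i j => W (e (.inl i)) (e (.inr j)))
          (-Matrix.of fun i j => W (e (.inl i)) (e (.inr j))).transpose
          (Matrix.of fun j j' => (if j = j' then 2 * β (e (.inr j)) else 0)
            - W (e (.inr j)) (e (.inr j'))) := by
  ext x y
  rcases x with i | j <;> rcases y with i' | j' <;>
    simp only [Matrix.submatrix_apply, hMatrix_apply, Matrix.fromBlocks_apply₁₁,
      Matrix.fromBlocks_apply₁₂, Matrix.fromBlocks_apply₂₁, Matrix.fromBlocks_apply₂₂,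
      e.apply_eq_iff_eq, Sum.inl.injEq, Sum.inr.injEq, Matrix.of_apply, Matrix.neg_apply,
      Matrix.transpose_apply, reduceCtorEq, if_false, zero_sub, Matrix.diagonal_apply]
  · split_ifs with h
    · rw [h]
    · rw [h0 i i' h, sub_zero]
  · rw [hW.apply]

omit [Fintype J] [Fintype Λ] [DecidableEq Λ] in
/-- The matrix `H` of the reduced weights is the Schur complement of the block `I` in `H_β`. -/
theorem hMatrix_reducedMatrix (W : Matrix Λ Λ ℝ) (e : I ⊕ J ≃ Λ) (β : Λ → ℝ) :
    hMatrix (reducedMatrix W e fun i => β (e (.inl i))) (fun j => β (e (.inr j)))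
      = (Matrix.of fun j j' => (if j = j' then 2 * β (e (.inr j)) else 0)
            - W (e (.inr j)) (e (.inr j')))
        - (Matrix.of fun i j => W (e (.inl i)) (e (.inr j))).transpose
          * Matrix.diagonal (fun i => (2 * β (e (.inl i)) - W (e (.inl i)) (e (.inl i)))⁻¹)
          * (Matrix.of fun i j => W (e (.inl i)) (e (.inr j))) := by
  ext j j'
  rw [Matrix.sub_apply, transpose_mul_diagonal_mul_apply, hMatrix_apply, reducedMatrix]
  simp only [Matrix.of_apply]
  ring

theorem betaDensity_hMatrix_eq_prod_mul (W : Matrix Λ Λ ℝ) (hW : W.IsSymm) (e : I ⊕ J ≃ Λ)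
    (h0 : ∀ i i', i ≠ i' → W (e (.inl i)) (e (.inl i')) = 0) (β : Λ → ℝ) :
    betaDensity (hMatrix W β)
      = (∏ i, pivotDensity (∑ j, W (e (.inl i)) (e (.inr j)))
          (2 * β (e (.inl i)) - W (e (.inl i)) (e (.inl i))))
        * betaDensity (hMatrix (reducedMatrix W e fun i => β (e (.inl i)))
            fun j => β (e (.inr j))) := by
  rw [← betaDensity_submatrix_equiv _ e, hMatrix_submatrix_eq_fromBlocks W hW e h0 β,
    betaDensity_fromBlocks, hMatrix_reducedMatrix]
  rfl

/-- Elimination of `I` does not change the inverse of `H_β` on `J`. -/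
theorem inv_hMatrix_reducedMatrix (W : Matrix Λ Λ ℝ) (hW : W.IsSymm) (e : I ⊕ J ≃ Λ)
    (h0 : ∀ i i', i ≠ i' → W (e (.inl i)) (e (.inl i')) = 0) (β : Λ → ℝ)
    (hH : (hMatrix W β).PosDef) :
    (hMatrix (reducedMatrix W e fun i => β (e (.inl i))) fun j => β (e (.inr j)))⁻¹
      = (hMatrix W β)⁻¹.submatrix (fun j => e (.inr j)) (fun j => e (.inr j)) := by
  have hH' : ((hMatrix W β).submatrix e e).PosDef := hH.submatrix e.injective
  have hinv : ((hMatrix W β).submatrix e e)⁻¹ = (hMatrix W β)⁻¹.submatrix e e :=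
    Matrix.inv_submatrix_equiv _ _ _
  rw [hMatrix_submatrix_eq_fromBlocks W hW e h0 β] at hH' hinv
  have hA : (Matrix.diagonal fun i =>
      2 * β (e (.inl i)) - W (e (.inl i)) (e (.inl i))).PosDef := hH'.submatrix Sum.inl_injective
  have hd := Matrix.posDef_diagonal_iff.1 hA
  have h1 := toBlocks₂₂_inv_fromBlocks _ _ hA hH'
  rw [hinv] at h1
  rw [hMatrix_reducedMatrix]
  have h2 : (Matrix.diagonal fun i => 2 * β (e (.inl i)) - W (e (.inl i)) (e (.inl i)))⁻¹
    = Matrix.diagonal fun i => (2 * β (e (.inl i)) - W (e (.inl i)) (e (.inl i)))⁻¹ :=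
    inv_diagonal_of_pos hd
  have h3 : ∀ B : Matrix I J ℝ, ∀ D : Matrix I I ℝ,
      (-B).transpose * D * (-B) = B.transpose * D * B := by
    intro B D
    simp
  rw [← h2, ← h3]
  exact h1.symm

omit [Fintype J] [Fintype Λ] [DecidableEq I] [DecidableEq J] [DecidableEq Λ] in
theorem reducedMatrix_isSymm (W : Matrix Λ Λ ℝ) (hW : W.IsSymm) (e : I ⊕ J ≃ Λ) (b : I → ℝ) :
    (reducedMatrix W e b).IsSymm := by
  ext j j'
  simp only [Matrix.transpose_apply, reducedMatrix]
  rw [hW.apply]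
  congr 1
  exact Finset.sum_congr rfl fun i _ => by ring

omit [Fintype Λ] in
theorem measurable_hMatrix_apply (W : Matrix Λ Λ ℝ) (x y : Λ) :
    Measurable fun β : Λ → ℝ => hMatrix W β x y := by
  simp only [hMatrix_apply]
  split_ifs <;> fun_prop

/-- The density of the field has total mass `1` for every nonnegative weight matrix. The vertices
are eliminated one at a time; each contributes the total mass of the law of a pivot. -/
theorem lintegral_betaDensity (W : Matrix Λ Λ ℝ) (hW : W.IsSymm)
    (hnn : ∀ x y, x ≠ y → 0 ≤ W x y) : ∫⁻ β, betaDensity (hMatrix W β) = 1 := by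
  classical
  induction hn : Fintype.card Λ generalizing Λ with
  | zero =>
    have := Fintype.card_eq_zero_iff.1 hn
    have h : ∀ H : Matrix Λ Λ ℝ, betaDensity H = 1 := by
      intro H
      have hH : H.PosDef := by
        rw [Subsingleton.elim H 1]
        exact Matrix.PosDef.one
      rw [betaDensity_of_posDef hH, hn]
      simp
    simp only [h, lintegral_one]
    rw [volume_pi, Measure.pi_of_empty]
    simp
  | succ n ih =>
    have hne : Nonempty Λ := Fintype.card_pos_iff.1 (by omega)
    obtain ⟨a⟩ := hne
    let e : {x // x = a} ⊕ {x // x ≠ a} ≃ Λ := Equiv.sumCompl (· = a)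
    have he1 : ∀ i, e (.inl i) = a := fun i => i.2
    have he2 : ∀ j, e (.inr j) = (j : Λ) := fun j => rfl
    have h0 : ∀ i i', i ≠ i' → W (e (.inl i)) (e (.inl i')) = 0 := fun i i' h =>
      absurd (Subsingleton.elim i i') h
    have hcard : Fintype.card {x // x ≠ a} = n := by
      rw [Fintype.card_subtype_compl, hn]
      simp
    have hmp := measurePreserving_sumElim_comp (volume : Measure ℝ) e
    have hmeas : Measurable fun β : Λ → ℝ => betaDensity (hMatrix W β) :=
      measurable_betaDensity (measurable_hMatrix_apply W)
    have hmeas' : Measurable fun p : ({x // x = a} → ℝ) × ({x // x ≠ a} → ℝ) =>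
        betaDensity (hMatrix W fun x => Sum.elim p.1 p.2 (e.symm x)) := hmeas.comp hmp.measurable
    rw [volume_pi, ← hmp.lintegral_comp hmeas, lintegral_prod _ hmeas'.aemeasurable]
    set η := ∑ j : {x // x ≠ a}, W a j
    have hη : 0 ≤ η := Finset.sum_nonneg fun j _ => hnn a j j.2.symm
    have hinner : ∀ b : {x // x = a} → ℝ,
        ∫⁻ c, betaDensity (hMatrix W fun x => Sum.elim b c (e.symm x))
            ∂(Measure.pi fun _ : {x // x ≠ a} => (volume : Measure ℝ))
          = pivotDensity η (2 * b default - W a a) := by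
      intro b
      have hfac : ∀ c, betaDensity (hMatrix W fun x => Sum.elim b c (e.symm x))
          = pivotDensity η (2 * b default - W a a)
            * betaDensity (hMatrix (reducedMatrix W e b) c) := by
        intro c
        rw [betaDensity_hMatrix_eq_prod_mul W hW e h0]
        simp only [Equiv.symm_apply_apply, Sum.elim_inl, Sum.elim_inr, Fintype.prod_unique]
        simp only [he1]
        rfl
      simp only [hfac]
      rw [lintegral_const_mul _ (measurable_betaDensity (measurable_hMatrix_apply _))]
      -- nonnegativity of the reduced weights needs a positive pivot; otherwise both sides vanish
      by_cases hb : 0 < 2 * b default - W a a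
      · have := ih (reducedMatrix W e b) (reducedMatrix_isSymm W hW e b) (fun x y hxy => by
          have h1 : 0 ≤ W (e (.inr x)) (e (.inr y)) := hnn _ _ fun h => hxy (Subtype.ext h)
          refine add_nonneg h1 (Finset.sum_nonneg fun i _ => ?_)
          have h2 : ∀ x, 0 ≤ W (e (.inl i)) (e (.inr x)) := fun x => by
            rw [he1]
            exact hnn _ _ x.2.symm
          have h3 : 0 < 2 * b i - W (e (.inl i)) (e (.inl i)) := by
            rw [he1, Subsingleton.elim i default]
            exact hb
          exact mul_nonneg (mul_nonneg (h2 x) (inv_nonneg.2 h3.le)) (h2 y)) hcard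
        rw [volume_pi] at this
        rw [this, mul_one]
      · simp [pivotDensity, hb]
    calc ∫⁻ b, ∫⁻ c, betaDensity (hMatrix W fun x => Sum.elim b c (e.symm x))
            ∂(Measure.pi fun _ : {x // x ≠ a} => (volume : Measure ℝ))
            ∂(Measure.pi fun _ : {x // x = a} => (volume : Measure ℝ))
        = ∫⁻ b : {x // x = a} → ℝ, pivotDensity η (2 * b default - W a a) := by
          simp only [hinner]
          rfl
      _ = ∫⁻ t : ℝ, pivotDensity η (2 * t - W a a) :=
          (volume_preserving_funUnique {x // x = a} ℝ).lintegral_comp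
            (f := fun t => pivotDensity η (2 * t - W a a))
            (measurable_pivotDensity.comp (measurable_const.prodMk (by fun_prop)))
      _ = ∫⁻ t : ℝ, pivotDensity η (2 * (t - W a a / 2)) := by
          refine lintegral_congr fun t => ?_
          congr 1
          ring
      _ = ∫⁻ t : ℝ, pivotDensity η (2 * t) :=
          lintegral_sub_right_eq_self (fun t => pivotDensity η (2 * t)) (W a a / 2)
      _ = 1 := lintegral_pivotDensity hη

end Elimination

/-! ### Combinatorics of the subdivided graphs -/

section Subdivision

variable {V : Type*} {G : SimpleGraph V}

/-- The first end of an edge of the subdivided graph. -/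
def edgeFst (dir : G.edgeSet → G.Dart) (m : ℕ) (a : SubdivEdge G m) : SubdivVertex G m :=
  subdivPoint dir m a.1 a.2

/-- The second end of an edge of the subdivided graph. -/
def edgeSnd (dir : G.edgeSet → G.Dart) (m : ℕ) (a : SubdivEdge G m) : SubdivVertex G m :=
  subdivPoint dir m a.1 (a.2 + 1)

/-- The midpoint of an edge of the `2^m`-subdivision, a vertex of the `2^(m+1)`-subdivision. -/
def midpointVertex (m : ℕ) (a : SubdivEdge G m) : SubdivVertex G (m + 1) :=
  Sum.inr (a.1, ⟨2 * a.2 + 1, Finset.mem_Ioo.2 ⟨by omega, by have := a.2.2; omega⟩⟩)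

theorem subdivIncl_self (m : ℕ) (h : m ≤ m) (x : SubdivVertex G m) : subdivIncl h x = x := by
  rcases x with v | ⟨e, k⟩
  · rfl
  · simp [subdivIncl]

theorem subdivIncl_injective {l r : ℕ} (h : l ≤ r) :
    Function.Injective (subdivIncl (G := G) h) := by
  refine Function.injective_id.sumMap (Function.injective_id.prodMap fun k k' hk => Subtype.ext ?_)
  exact Nat.eq_of_mul_eq_mul_right (pow_pos two_pos (r - l)) (congrArg Subtype.val hk)

theorem subdivIncl_comp {l m r : ℕ} (h : l ≤ m) (h' : m ≤ r) (x : SubdivVertex G l) :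
    subdivIncl h' (subdivIncl h x) = subdivIncl (h.trans h') x := by
  rcases x with v | ⟨e, k⟩
  · rfl
  · simp only [subdivIncl, Sum.map_inr, Prod.map, id]
    congr 3
    rw [mul_assoc, ← pow_add]
    congr 2
    omega

/-- The vertices of the `2^(m+1)`-subdivision are the midpoints of the edges of the
`2^m`-subdivision together with the vertices of the `2^m`-subdivision. -/
def vertexEquiv (G : SimpleGraph V) (m : ℕ) :
    SubdivEdge G m ⊕ SubdivVertex G m ≃ SubdivVertex G (m + 1) :=
  Equiv.ofBijective (Sum.elim (midpointVertex m) (subdivIncl (Nat.le_succ m))) <| by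
    constructor
    · rintro (⟨e, k⟩ | x) (⟨e', k'⟩ | x') h
      · simp [midpointVertex] at h
        rw [h.1, Fin.ext h.2]
      · rcases x' with v | ⟨e', k'⟩
        · simp [midpointVertex, subdivIncl] at h
        · simp [midpointVertex, subdivIncl] at h
          omega
      · rcases x with v | ⟨e, k⟩
        · simp [midpointVertex, subdivIncl] at h
        · simp [midpointVertex, subdivIncl] at h
          omega
      · exact congrArg Sum.inr (subdivIncl_injective (Nat.le_succ m) h)
    · rintro (v | ⟨e, k, hk⟩)
      · exact ⟨.inr (.inl v), rfl⟩
      · have hk' := Finset.mem_Ioo.1 hk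
        have h2 : 2 ^ (m + 1) = 2 * 2 ^ m := by ring
        rcases Nat.even_or_odd' k with ⟨j, rfl | rfl⟩
        · refine ⟨.inr (.inr (e, ⟨j, Finset.mem_Ioo.2 ⟨by omega, by omega⟩⟩)), ?_⟩
          simp [subdivIncl, mul_comm]
        · refine ⟨.inl (e, ⟨j, by omega⟩), ?_⟩
          simp [midpointVertex]

/-- Each edge of the `2^m`-subdivision is divided into two edges of the `2^(m+1)`-subdivision. -/
def edgeEquiv (G : SimpleGraph V) (m : ℕ) :
    SubdivEdge G m ⊕ SubdivEdge G m ≃ SubdivEdge G (m + 1) :=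
  Equiv.ofBijective (Sum.elim (fun a => (a.1, ⟨2 * a.2, by have := a.2.2; omega⟩))
    (fun a => (a.1, ⟨2 * a.2 + 1, by have := a.2.2; omega⟩))) <| by
    constructor
    · rintro (⟨e, k⟩ | ⟨e, k⟩) (⟨e', k'⟩ | ⟨e', k'⟩) h <;> simp at h
      · rw [h.1, Fin.ext h.2]
      · omega
      · omega
      · rw [h.1, Fin.ext h.2]
    · rintro ⟨e, k, _⟩
      have h2 : 2 ^ (m + 1) = 2 * 2 ^ m := by ring
      rcases Nat.even_or_odd' k with ⟨j, rfl | rfl⟩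
      · exact ⟨.inl (e, ⟨j, by omega⟩), rfl⟩
      · exact ⟨.inr (e, ⟨j, by omega⟩), rfl⟩

variable (dir : G.edgeSet → G.Dart)

theorem subdivPoint_two_mul (m : ℕ) (e : G.edgeSet) (k : ℕ) :
    subdivPoint dir (m + 1) e (2 * k) = subdivIncl (Nat.le_succ m) (subdivPoint dir m e k) := by
  have h2 : 2 ^ (m + 1) = 2 * 2 ^ m := by ring
  unfold subdivPoint
  by_cases h : k ∈ Finset.Ioo 0 (2 ^ m)
  · have h' : 2 * k ∈ Finset.Ioo 0 (2 ^ (m + 1)) := by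
      rw [Finset.mem_Ioo] at h ⊢
      omega
    rw [dif_pos h, dif_pos h']
    simp [subdivIncl, mul_comm]
  · have h' : 2 * k ∉ Finset.Ioo 0 (2 ^ (m + 1)) := by
      rw [Finset.mem_Ioo] at h ⊢
      omega
    rw [dif_neg h, dif_neg h']
    by_cases h0 : k = 0 <;> simp [h0, subdivIncl]

theorem subdivPoint_two_mul_add_one (m : ℕ) (a : SubdivEdge G m) :
    subdivPoint dir (m + 1) a.1 (2 * a.2 + 1) = midpointVertex m a := by
  have h : 2 * (a.2 : ℕ) + 1 ∈ Finset.Ioo 0 (2 ^ (m + 1)) :=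
    Finset.mem_Ioo.2 ⟨by omega, by have := a.2.2; omega⟩
  unfold subdivPoint
  rw [dif_pos h]
  rfl

theorem edgeFst_edgeEquiv_inl (m : ℕ) (a : SubdivEdge G m) :
    edgeFst dir (m + 1) (edgeEquiv G m (.inl a)) = vertexEquiv G m (.inr (edgeFst dir m a)) :=
  subdivPoint_two_mul dir m a.1 a.2

theorem edgeSnd_edgeEquiv_inl (m : ℕ) (a : SubdivEdge G m) :
    edgeSnd dir (m + 1) (edgeEquiv G m (.inl a)) = vertexEquiv G m (.inl a) :=
  subdivPoint_two_mul_add_one dir m a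

theorem edgeFst_edgeEquiv_inr (m : ℕ) (a : SubdivEdge G m) :
    edgeFst dir (m + 1) (edgeEquiv G m (.inr a)) = vertexEquiv G m (.inl a) :=
  subdivPoint_two_mul_add_one dir m a

theorem edgeSnd_edgeEquiv_inr (m : ℕ) (a : SubdivEdge G m) :
    edgeSnd dir (m + 1) (edgeEquiv G m (.inr a)) = vertexEquiv G m (.inr (edgeSnd dir m a)) :=
  subdivPoint_two_mul dir m a.1 (a.2 + 1)

theorem edgeFst_ne_edgeSnd (m : ℕ) (a : SubdivEdge G m) : edgeFst dir m a ≠ edgeSnd dir m a := by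
  cases m with
  | zero =>
    obtain ⟨e, k, hk⟩ := a
    have hk0 : k = 0 := by simpa using hk
    subst hk0
    simp [edgeFst, edgeSnd, subdivPoint, (dir e).fst_ne_snd]
  | succ m =>
    obtain ⟨b | b, rfl⟩ := (edgeEquiv G m).surjective a
    · rw [edgeFst_edgeEquiv_inl, edgeSnd_edgeEquiv_inl]
      simp
    · rw [edgeFst_edgeEquiv_inr, edgeSnd_edgeEquiv_inr]
      simp

theorem subdivEnds_eq (m : ℕ) (a : SubdivEdge G m) :
    subdivEnds dir m a = s(edgeFst dir m a, edgeSnd dir m a) := rfl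

/-- The subdivided graphs have no multiple edges. -/
theorem subdivEnds_injective (hdir : ∀ e, (dir e).edge = e) (m : ℕ) :
    Function.Injective (subdivEnds dir m) := by
  intro a a' h
  cases m with
  | zero =>
    obtain ⟨e, k, hk⟩ := a
    obtain ⟨e', k', hk'⟩ := a'
    have hk0 : k = 0 := by simpa using hk
    have hk0' : k' = 0 := by simpa using hk'
    subst hk0 hk0'
    have h1 : (dir e).edge = (dir e').edge := by
      have h2 := h
      simp only [subdivEnds, subdivPoint] at h2
      have h3 : Sym2.map Sum.inl s((dir e).fst, (dir e).snd)
          = (Sym2.map Sum.inl s((dir e').fst, (dir e').snd) : Sym2 (SubdivVertex G 0)) := by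
        simpa using h2
      exact Sym2.map.injective Sum.inl_injective h3
    rw [hdir, hdir] at h1
    rw [Subtype.ext h1]
  | succ m =>
    have hne := edgeFst_ne_edgeSnd dir m
    rw [subdivEnds_eq, subdivEnds_eq] at h
    obtain ⟨b | b, rfl⟩ := (edgeEquiv G m).surjective a <;>
      obtain ⟨b' | b', rfl⟩ := (edgeEquiv G m).surjective a' <;>
      simp only [edgeFst_edgeEquiv_inl, edgeSnd_edgeEquiv_inl, edgeFst_edgeEquiv_inr,
        edgeSnd_edgeEquiv_inr, Sym2.eq_iff, (vertexEquiv G m).apply_eq_iff_eq, Sum.inl.injEq,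
        Sum.inr.injEq, reduceCtorEq, and_false, or_false, false_or] at h
    · rw [h.2]
    · obtain ⟨h1, rfl⟩ := h
      exact absurd h1 (hne _)
    · obtain ⟨rfl, h1⟩ := h
      exact absurd h1.symm (hne _)
    · rw [h.1]

variable [Fintype V] [DecidableEq V] [DecidableRel G.Adj]

theorem weightMatrix_isSymm (m : ℕ) (w : SubdivEdge G m → ℝ) :
    (weightMatrix dir m w).IsSymm := by
  ext x y
  simp only [Matrix.transpose_apply, weightMatrix, Sym2.eq_swap (a := x)]

theorem weightMatrix_nonneg (m : ℕ) {w : SubdivEdge G m → ℝ} (hw : ∀ a, 0 ≤ w a)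
    (x y : SubdivVertex G m) : 0 ≤ weightMatrix dir m w x y := by
  unfold weightMatrix
  refine Finset.sum_nonneg fun a _ => ?_
  split_ifs
  · exact hw a
  · exact le_rfl

theorem weightMatrix_edge (hdir : ∀ e, (dir e).edge = e) (m : ℕ) (w : SubdivEdge G m → ℝ)
    (a : SubdivEdge G m) : weightMatrix dir m w (edgeFst dir m a) (edgeSnd dir m a) = w a := by
  unfold weightMatrix
  rw [Finset.sum_eq_single a]
  · rw [if_pos (subdivEnds_eq dir m a)]
  · intro b _ hb
    rw [if_neg]
    intro h
    exact hb (subdivEnds_injective dir hdir m h)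
  · simp

theorem weightMatrix_self (m : ℕ) (w : SubdivEdge G m → ℝ) (x : SubdivVertex G m) :
    weightMatrix dir m w x x = 0 := by
  unfold weightMatrix
  refine Finset.sum_eq_zero fun a _ => if_neg ?_
  rw [subdivEnds_eq, Sym2.eq_iff]
  have := edgeFst_ne_edgeSnd dir m a
  rintro (⟨h1, h2⟩ | ⟨h1, h2⟩) <;> exact this (h1.trans h2.symm)

theorem weightMatrix_succ (m : ℕ) (w : SubdivEdge G (m + 1) → ℝ)
    (x y : SubdivEdge G m ⊕ SubdivVertex G m) :
    weightMatrix dir (m + 1) w (vertexEquiv G m x) (vertexEquiv G m y)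
      = ∑ a, (if s(.inr (edgeFst dir m a), .inl a) = s(x, y) then w (edgeEquiv G m (.inl a)) else 0)
        + ∑ a, (if s(.inl a, .inr (edgeSnd dir m a)) = s(x, y)
            then w (edgeEquiv G m (.inr a)) else 0) := by
  unfold weightMatrix
  rw [← (edgeEquiv G m).sum_comp, Fintype.sum_sum_type]
  congr 1
  · refine Finset.sum_congr rfl fun a _ => if_congr ?_ rfl rfl
    rw [subdivEnds_eq, edgeFst_edgeEquiv_inl, edgeSnd_edgeEquiv_inl]
    simp only [Sym2.eq_iff, (vertexEquiv G m).apply_eq_iff_eq]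
  · refine Finset.sum_congr rfl fun a _ => if_congr ?_ rfl rfl
    rw [subdivEnds_eq, edgeFst_edgeEquiv_inr, edgeSnd_edgeEquiv_inr]
    simp only [Sym2.eq_iff, (vertexEquiv G m).apply_eq_iff_eq]

theorem weightMatrix_succ_inl_inl (m : ℕ) (w : SubdivEdge G (m + 1) → ℝ) (a b : SubdivEdge G m) :
    weightMatrix dir (m + 1) w (vertexEquiv G m (.inl a)) (vertexEquiv G m (.inl b)) = 0 := by
  rw [weightMatrix_succ]
  simp

theorem weightMatrix_succ_inr_inr (m : ℕ) (w : SubdivEdge G (m + 1) → ℝ)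
    (x y : SubdivVertex G m) :
    weightMatrix dir (m + 1) w (vertexEquiv G m (.inr x)) (vertexEquiv G m (.inr y)) = 0 := by
  rw [weightMatrix_succ]
  simp

theorem weightMatrix_succ_inl_inr (m : ℕ) (w : SubdivEdge G (m + 1) → ℝ) (a : SubdivEdge G m)
    (x : SubdivVertex G m) :
    weightMatrix dir (m + 1) w (vertexEquiv G m (.inl a)) (vertexEquiv G m (.inr x))
      = (if edgeFst dir m a = x then w (edgeEquiv G m (.inl a)) else 0)
        + (if edgeSnd dir m a = x then w (edgeEquiv G m (.inr a)) else 0) := by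
  rw [weightMatrix_succ]
  simp only [Sym2.eq_iff, Sum.inl.injEq, Sum.inr.injEq, reduceCtorEq, false_or, or_false,
    and_false]
  congr 1
  · rw [Finset.sum_eq_single a]
    · simp
    · intro b _ hb
      rw [if_neg fun h => hb h.2]
    · simp
  · rw [Finset.sum_eq_single a]
    · simp
    · intro b _ hb
      rw [if_neg fun h => hb h.1]
    · simp

theorem sum_weightMatrix_succ_inl (m : ℕ) (w : SubdivEdge G (m + 1) → ℝ) (a : SubdivEdge G m) :
    ∑ x, weightMatrix dir (m + 1) w (vertexEquiv G m (.inl a)) (vertexEquiv G m (.inr x))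
      = w (edgeEquiv G m (.inl a)) + w (edgeEquiv G m (.inr a)) := by
  simp only [weightMatrix_succ_inl_inr, Finset.sum_add_distrib, Finset.sum_ite_eq,
    Finset.mem_univ, if_true]

/-- The effective weights on the `2^m`-subdivision obtained from weights and a field on the
`2^(m+1)`-subdivision: two edges in series with weights `t₁`, `t₂` and field `β` at their common
end are replaced by one edge of weight `t₁ t₂ / (2 β)`. -/
def seriesWeight (m : ℕ) (w : SubdivEdge G (m + 1) → ℝ) (β : SubdivVertex G (m + 1) → ℝ)
    (a : SubdivEdge G m) : ℝ :=
  w (edgeEquiv G m (.inl a)) * w (edgeEquiv G m (.inr a)) / (2 * β (vertexEquiv G m (.inl a)))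

/-- Half of the diagonal entries of the effective weight matrix on the `2^m`-subdivision. The
field is translated by them, so that the reduced matrix has vanishing diagonal. -/
def fieldShift (m : ℕ) (w : SubdivEdge G (m + 1) → ℝ) (b : SubdivEdge G m → ℝ)
    (x : SubdivVertex G m) : ℝ :=
  (∑ a, ((if edgeFst dir m a = x then w (edgeEquiv G m (.inl a)) ^ 2 else 0)
    + (if edgeSnd dir m a = x then w (edgeEquiv G m (.inr a)) ^ 2 else 0)) / (2 * b a)) / 2

/-- The field on the `2^m`-subdivision that goes with `seriesWeight`. -/
def seriesField (m : ℕ) (w : SubdivEdge G (m + 1) → ℝ) (β : SubdivVertex G (m + 1) → ℝ)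
    (x : SubdivVertex G m) : ℝ :=
  β (vertexEquiv G m (.inr x)) - fieldShift dir m w (fun a => β (vertexEquiv G m (.inl a))) x

/-- Eliminating the midpoints of all edges gives the matrix `H` of the `2^m`-subdivision for the
reduced weights and the reduced field. -/
theorem hMatrix_reducedMatrix_weightMatrix (m : ℕ) (w : SubdivEdge G (m + 1) → ℝ)
    (β : SubdivVertex G (m + 1) → ℝ) :
    hMatrix (reducedMatrix (weightMatrix dir (m + 1) w) (vertexEquiv G m)
        fun a => β (vertexEquiv G m (.inl a))) (fun x => β (vertexEquiv G m (.inr x)))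
      = hMatrix (weightMatrix dir m (seriesWeight m w β)) (seriesField dir m w β) := by
  ext x y
  simp only [hMatrix_apply, reducedMatrix, weightMatrix_succ_inr_inr, zero_add,
    weightMatrix_succ_inl_inl, sub_zero, weightMatrix_succ_inl_inr]
  by_cases hxy : x = y
  · subst hxy
    rw [weightMatrix_self]
    simp only [if_true, sub_zero, seriesField, fieldShift]
    rw [mul_sub, mul_div_cancel₀ _ (two_ne_zero' ℝ)]
    congr 1
    refine Finset.sum_congr rfl fun a _ => ?_
    have hne := edgeFst_ne_edgeSnd dir m a
    by_cases h1 : edgeFst dir m a = x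
    · have h2 : ¬ edgeSnd dir m a = x := fun h => hne (h1.trans h.symm)
      simp only [h1, h2, if_true, if_false, add_zero]
      ring
    · simp only [h1, if_false, zero_add]
      split_ifs <;> ring
  · simp only [hxy, if_false, zero_sub]
    congr 1
    unfold weightMatrix
    refine Finset.sum_congr rfl fun a _ => ?_
    rw [subdivEnds_eq]
    have hne := edgeFst_ne_edgeSnd dir m a
    simp only [Sym2.eq_iff, seriesWeight]
    by_cases h1 : edgeFst dir m a = x
    · have h2 : ¬ edgeSnd dir m a = x := fun h => hne (h1.trans h.symm)
      have h3 : ¬ edgeFst dir m a = y := fun h => hxy (h1.symm.trans h)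
      simp only [h1, h2, hxy, if_true, if_false, add_zero, zero_add, true_and, false_and, or_false]
      split_ifs <;> ring
    · by_cases h2 : edgeSnd dir m a = x
      · have h3 : ¬ edgeSnd dir m a = y := fun h => hxy (h2.symm.trans h)
        simp only [h1, h2, hxy, if_true, if_false, add_zero, zero_add, and_true, false_and,
          false_or]
        split_ifs <;> ring
      · simp [h1, h2]

end Subdivision

/-! ### The law of the field under one step of the reduction -/

section Reduction

/-- The joint law of two independent weights `t₁, t₂` with law `ν` and of the field `b` at the
common end of their edges, so that `2 b` is a pivot with parameter `t₁ + t₂`. -/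
def pivotLaw (ν : Measure ℝ) : Measure ((ℝ × ℝ) × ℝ) :=
  ((ν.prod ν).prod volume).withDensity fun p => pivotDensity (p.1.1 + p.1.2) (2 * p.2)

/-- The weight that replaces two edges in series, as a function of the two weights and the field at
their common end. -/
def combineSeries (p : (ℝ × ℝ) × ℝ) : ℝ := p.1.1 * p.1.2 / (2 * p.2)

/-- The law of the weight that replaces two edges in series. -/
def seriesLaw (ν : Measure ℝ) : Measure ℝ := (pivotLaw ν).map combineSeries

theorem measurable_combineSeries : Measurable combineSeries := by
  unfold combineSeries
  fun_prop

theorem measurable_pivotDensity_add :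
    Measurable fun p : (ℝ × ℝ) × ℝ => pivotDensity (p.1.1 + p.1.2) (2 * p.2) :=
  measurable_pivotDensity.comp (f := fun p : (ℝ × ℝ) × ℝ => (p.1.1 + p.1.2, 2 * p.2))
    (by fun_prop)

theorem ae_prod_pos {ν : Measure ℝ} [IsProbabilityMeasure ν] (hν : ∀ᵐ t ∂ν, 0 < t) :
    ∀ᵐ q ∂ν.prod ν, 0 < q.1 ∧ 0 < q.2 := by
  have h1 := Measure.quasiMeasurePreserving_fst (μ := ν) (ν := ν) |>.ae hν
  have h2 := Measure.quasiMeasurePreserving_snd (μ := ν) (ν := ν) |>.ae hν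
  filter_upwards [h1, h2] with q h1 h2 using ⟨h1, h2⟩

theorem lintegral_pivotLaw {ν : Measure ℝ} [IsProbabilityMeasure ν]
    {F : (ℝ × ℝ) × ℝ → ℝ≥0∞} (hF : Measurable F) :
    ∫⁻ p, F p ∂pivotLaw ν
      = ∫⁻ q, (∫⁻ b : ℝ, pivotDensity (q.1 + q.2) (2 * b) * F (q, b)) ∂(ν.prod ν) := by
  rw [pivotLaw, lintegral_withDensity_eq_lintegral_mul _ measurable_pivotDensity_add hF,
    lintegral_prod _ (measurable_pivotDensity_add.mul hF).aemeasurable]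
  rfl

theorem isProbabilityMeasure_pivotLaw {ν : Measure ℝ} [IsProbabilityMeasure ν]
    (hν : ∀ᵐ t ∂ν, 0 < t) : IsProbabilityMeasure (pivotLaw ν) := by
  constructor
  rw [← lintegral_one, lintegral_pivotLaw measurable_const]
  simp only [mul_one]
  rw [lintegral_congr_ae (g := fun _ => 1)]
  · simp
  · filter_upwards [ae_prod_pos hν] with q hq
    exact lintegral_pivotDensity (add_pos hq.1 hq.2).le

theorem ae_pivotLaw_pos {ν : Measure ℝ} [IsProbabilityMeasure ν] (hν : ∀ᵐ t ∂ν, 0 < t) :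
    ∀ᵐ p ∂pivotLaw ν, (0 < p.1.1 ∧ 0 < p.1.2) ∧ 0 < 2 * p.2 := by
  have h1 : ∀ᵐ p ∂pivotLaw ν, 0 < p.1.1 ∧ 0 < p.1.2 := by
    refine (withDensity_absolutelyContinuous _ _).ae_le ?_
    exact Measure.quasiMeasurePreserving_fst.ae (ae_prod_pos hν)
  have h2 : ∀ᵐ p ∂pivotLaw ν, 0 < 2 * p.2 := by
    refine (ae_withDensity_iff measurable_pivotDensity_add).2 (Filter.Eventually.of_forall ?_)
    intro p hp
    by_contra h
    exact hp (if_neg h)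
  filter_upwards [h1, h2] with p h1 h2 using ⟨h1, h2⟩

theorem isProbabilityMeasure_seriesLaw {ν : Measure ℝ} [IsProbabilityMeasure ν]
    (hν : ∀ᵐ t ∂ν, 0 < t) : IsProbabilityMeasure (seriesLaw ν) :=
  have := isProbabilityMeasure_pivotLaw hν
  Measure.isProbabilityMeasure_map measurable_combineSeries.aemeasurable

theorem combineSeries_pos {p : (ℝ × ℝ) × ℝ} (hp : (0 < p.1.1 ∧ 0 < p.1.2) ∧ 0 < 2 * p.2) :
    0 < combineSeries p :=
  div_pos (mul_pos hp.1.1 hp.1.2) hp.2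

theorem ae_seriesLaw_pos {ν : Measure ℝ} [IsProbabilityMeasure ν] (hν : ∀ᵐ t ∂ν, 0 < t) :
    ∀ᵐ t ∂seriesLaw ν, 0 < t := by
  refine (ae_map_iff measurable_combineSeries.aemeasurable measurableSet_Ioi).2 ?_
  filter_upwards [ae_pivotLaw_pos hν] with p hp using combineSeries_pos hp

/-- Independent weights on two copies of `E` and, given them, independent pivots, amount to
independent copies of `pivotLaw ν` indexed by `E`. -/
theorem lintegral_pi_pivotDensity {E E' : Type*} [Fintype E] [Fintype E'] (e : E ⊕ E ≃ E')
    {ν : Measure ℝ} [IsProbabilityMeasure ν] (hν : ∀ᵐ t ∂ν, 0 < t)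
    {K : (E → (ℝ × ℝ) × ℝ) → ℝ≥0∞} (hK : Measurable K) :
    ∫⁻ w, ∫⁻ b, (∏ a, pivotDensity (w (e (.inl a)) + w (e (.inr a))) (2 * b a))
        * K (fun a => ((w (e (.inl a)), w (e (.inr a))), b a))
        ∂(Measure.pi fun _ : E => (volume : Measure ℝ)) ∂(Measure.pi fun _ : E' => ν)
      = ∫⁻ x, K x ∂(Measure.pi fun _ : E => pivotLaw ν) := by
  have := isProbabilityMeasure_pivotLaw hν
  have hA := measurePreserving_arrowProdEquivProdArrow (ℝ × ℝ) ℝ E (fun _ => ν.prod ν)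
    (fun _ => volume)
  have hB := measurePreserving_arrowProdEquivProdArrow ℝ ℝ E (fun _ => ν) (fun _ => ν)
  have hC := measurePreserving_sumElim_comp ν e
  have hD := ((hC.comp hB).prod
    (MeasurePreserving.id (Measure.pi fun _ : E => (volume : Measure ℝ)))).comp hA
  have hk : Measurable fun x : E → (ℝ × ℝ) × ℝ =>
      ∏ a, pivotDensity ((x a).1.1 + (x a).1.2) (2 * (x a).2) :=
    Finset.measurable_prod _ fun a _ => measurable_pivotDensity_add.comp (measurable_pi_apply a)
  have hx : Measurable fun p : (E' → ℝ) × (E → ℝ) =>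
      fun a => ((p.1 (e (.inl a)), p.1 (e (.inr a))), p.2 a) := by
    fun_prop
  have hmeas : Measurable fun p : (E' → ℝ) × (E → ℝ) =>
      (∏ a, pivotDensity (p.1 (e (.inl a)) + p.1 (e (.inr a))) (2 * p.2 a))
        * K (fun a => ((p.1 (e (.inl a)), p.1 (e (.inr a))), p.2 a)) :=
    (hk.comp hx).mul (hK.comp hx)
  have hsf : SigmaFinite (((ν.prod ν).prod volume).withDensity
      fun p : (ℝ × ℝ) × ℝ => pivotDensity (p.1.1 + p.1.2) (2 * p.2)) := by
    change SigmaFinite (pivotLaw ν)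
    infer_instance
  have hpi : (Measure.pi fun _ : E => pivotLaw ν) = _ :=
    pi_withDensity ((ν.prod ν).prod volume)
      (fun p => pivotDensity (p.1.1 + p.1.2) (2 * p.2)) measurable_pivotDensity_add
  rw [hpi, lintegral_withDensity_eq_lintegral_mul _ hk hK,
    ← lintegral_prod _ hmeas.aemeasurable, ← hD.lintegral_comp hmeas]
  refine lintegral_congr fun x => ?_
  simp only [Function.comp_apply, Pi.mul_apply, Prod.map, id, Equiv.symm_apply_apply,
    Sum.elim_inl, Sum.elim_inr]
  rfl

variable {V : Type*} [Fintype V] [DecidableEq V] {G : SimpleGraph V} [DecidableRel G.Adj]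
  (dir : G.edgeSet → G.Dart)

/-- The joint law of independent weights with law `ν` on the edges of the `2^m`-subdivision and of
the field that belongs to them. -/
def fieldLaw (m : ℕ) (ν : Measure ℝ) :
    Measure ((SubdivEdge G m → ℝ) × (SubdivVertex G m → ℝ)) :=
  ((Measure.pi fun _ => ν).prod volume).withDensity fun p =>
    betaDensity (hMatrix (weightMatrix dir m p.1) p.2)

theorem measurable_weightMatrix_apply {S : Type*} [MeasurableSpace S] (m : ℕ)
    {w : S → SubdivEdge G m → ℝ} (hw : Measurable w) (x y : SubdivVertex G m) :
    Measurable fun s => weightMatrix dir m (w s) x y := by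
  unfold weightMatrix
  refine Finset.measurable_sum _ fun a _ => ?_
  split_ifs <;> fun_prop

theorem measurable_betaDensity_weightMatrix {S : Type*} [MeasurableSpace S] (m : ℕ)
    {w : S → SubdivEdge G m → ℝ} (hw : Measurable w) {β : S → SubdivVertex G m → ℝ}
    (hβ : Measurable β) :
    Measurable fun s => betaDensity (hMatrix (weightMatrix dir m (w s)) (β s)) := by
  refine measurable_betaDensity fun x y => ?_
  simp only [hMatrix_apply]
  refine Measurable.sub ?_ (measurable_weightMatrix_apply dir m hw x y)
  split_ifs <;> fun_prop

/-- The two weights and the field at the common vertex for every edge of the `2^m`-subdivision. -/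
def pivotData (m : ℕ) (w : SubdivEdge G (m + 1) → ℝ) (β : SubdivVertex G (m + 1) → ℝ)
    (a : SubdivEdge G m) : (ℝ × ℝ) × ℝ :=
  ((w (edgeEquiv G m (.inl a)), w (edgeEquiv G m (.inr a))), β (vertexEquiv G m (.inl a)))

omit [Fintype V] [DecidableEq V] [DecidableRel G.Adj] in
theorem seriesWeight_eq (m : ℕ) (w : SubdivEdge G (m + 1) → ℝ)
    (β : SubdivVertex G (m + 1) → ℝ) :
    seriesWeight m w β = fun a => combineSeries (pivotData m w β a) := rfl

omit [Fintype V] [DecidableEq V] [DecidableRel G.Adj] in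
theorem measurable_pivotData (m : ℕ) :
    Measurable fun p : (SubdivEdge G (m + 1) → ℝ) × (SubdivVertex G (m + 1) → ℝ) =>
      pivotData m p.1 p.2 := by
  unfold pivotData
  fun_prop

theorem measurable_seriesField (m : ℕ) :
    Measurable fun p : (SubdivEdge G (m + 1) → ℝ) × (SubdivVertex G (m + 1) → ℝ) =>
      seriesField dir m p.1 p.2 := by
  refine measurable_pi_lambda _ fun x => ?_
  unfold seriesField fieldShift
  refine Measurable.sub (by fun_prop) (Measurable.div_const ?_ _)
  refine Finset.measurable_sum _ fun a _ => ?_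
  refine Measurable.div (Measurable.add ?_ ?_) (by fun_prop) <;> split_ifs <;> fun_prop

omit [Fintype V] [DecidableEq V] [DecidableRel G.Adj] in
theorem measurable_seriesWeight (m : ℕ) :
    Measurable fun p : (SubdivEdge G (m + 1) → ℝ) × (SubdivVertex G (m + 1) → ℝ) =>
      seriesWeight m p.1 p.2 := by
  unfold seriesWeight
  fun_prop

/-- For fixed weights, integration over the field splits into independent integrations over the
pivots at the midpoints and, after a translation, over the reduced field. -/
theorem lintegral_betaDensity_weightMatrix_succ (m : ℕ) (w : SubdivEdge G (m + 1) → ℝ)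
    {F : (SubdivEdge G m → (ℝ × ℝ) × ℝ) × (SubdivVertex G m → ℝ) → ℝ≥0∞} (hF : Measurable F) :
    ∫⁻ β, betaDensity (hMatrix (weightMatrix dir (m + 1) w) β)
        * F (pivotData m w β, seriesField dir m w β)
      = ∫⁻ b : SubdivEdge G m → ℝ,
        (∏ a, pivotDensity (w (edgeEquiv G m (.inl a)) + w (edgeEquiv G m (.inr a))) (2 * b a))
          * ∫⁻ c : SubdivVertex G m → ℝ,
            betaDensity (hMatrix (weightMatrix dir m fun a => combineSeries
              ((w (edgeEquiv G m (.inl a)), w (edgeEquiv G m (.inr a))), b a)) c)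
            * F (fun a => ((w (edgeEquiv G m (.inl a)), w (edgeEquiv G m (.inr a))), b a), c) := by
  have hmp := measurePreserving_sumElim_comp (volume : Measure ℝ) (vertexEquiv G m)
  have hmeas : Measurable fun β => betaDensity (hMatrix (weightMatrix dir (m + 1) w) β)
      * F (pivotData m w β, seriesField dir m w β) := by
    refine (measurable_betaDensity_weightMatrix dir (m + 1) measurable_const measurable_id).mul ?_
    exact hF.comp (((measurable_pivotData m).comp measurable_prodMk_left).prodMk
      ((measurable_seriesField dir m).comp measurable_prodMk_left))
  have hfac : ∀ (b : SubdivEdge G m → ℝ) (c : SubdivVertex G m → ℝ),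
      betaDensity (hMatrix (weightMatrix dir (m + 1) w)
          fun x => Sum.elim b c ((vertexEquiv G m).symm x))
        * F (pivotData m w fun x => Sum.elim b c ((vertexEquiv G m).symm x),
            seriesField dir m w fun x => Sum.elim b c ((vertexEquiv G m).symm x))
      = (∏ a, pivotDensity (w (edgeEquiv G m (.inl a)) + w (edgeEquiv G m (.inr a))) (2 * b a))
        * (fun c' => betaDensity (hMatrix (weightMatrix dir m fun a => combineSeries
              ((w (edgeEquiv G m (.inl a)), w (edgeEquiv G m (.inr a))), b a)) c')
            * F (fun a => ((w (edgeEquiv G m (.inl a)), w (edgeEquiv G m (.inr a))), b a), c'))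
          (c - fieldShift dir m w b) := by
    intro b c
    have e1 : (pivotData m w fun x => Sum.elim b c ((vertexEquiv G m).symm x))
        = fun a => ((w (edgeEquiv G m (.inl a)), w (edgeEquiv G m (.inr a))), b a) := by
      funext a
      simp [pivotData]
    have e2 : (seriesField dir m w fun x => Sum.elim b c ((vertexEquiv G m).symm x))
        = c - fieldShift dir m w b := by
      funext x
      simp [seriesField]
    rw [betaDensity_hMatrix_eq_prod_mul _ (weightMatrix_isSymm dir (m + 1) w) (vertexEquiv G m)
      fun i i' _ => weightMatrix_succ_inl_inl dir m w i i', hMatrix_reducedMatrix_weightMatrix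
        dir m w (fun x => Sum.elim b c ((vertexEquiv G m).symm x)), seriesWeight_eq, e1, e2]
    simp only [sum_weightMatrix_succ_inl, weightMatrix_succ_inl_inl, sub_zero,
      Equiv.symm_apply_apply, Sum.elim_inl, mul_assoc]
  have hmeas' : Measurable fun p : (SubdivEdge G m → ℝ) × (SubdivVertex G m → ℝ) =>
      betaDensity (hMatrix (weightMatrix dir (m + 1) w)
          fun x => Sum.elim p.1 p.2 ((vertexEquiv G m).symm x))
        * F (pivotData m w fun x => Sum.elim p.1 p.2 ((vertexEquiv G m).symm x),
            seriesField dir m w fun x => Sum.elim p.1 p.2 ((vertexEquiv G m).symm x)) :=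
    hmeas.comp hmp.measurable
  rw [volume_pi, ← hmp.lintegral_comp hmeas, lintegral_prod _ hmeas'.aemeasurable]
  refine lintegral_congr fun b => ?_
  simp only [hfac b]
  rw [← volume_pi, lintegral_const_mul]
  · congr 1
    exact lintegral_sub_right_eq_self (fun c : SubdivVertex G m → ℝ =>
      betaDensity (hMatrix (weightMatrix dir m fun a => combineSeries
        ((w (edgeEquiv G m (.inl a)), w (edgeEquiv G m (.inr a))), b a)) c)
      * F (fun a => ((w (edgeEquiv G m (.inl a)), w (edgeEquiv G m (.inr a))), b a), c)) _
  · refine Measurable.mul ?_ ?_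
    · exact measurable_betaDensity_weightMatrix dir m measurable_const
        (measurable_id.sub_const _)
    · exact hF.comp (measurable_const.prodMk (measurable_id.sub_const _))

/-- The key step: under `fieldLaw`, the data `pivotData` at the midpoints are independent with law
`pivotLaw ν`, and given them the reduced field has the law that belongs to the reduced weights. -/
theorem lintegral_fieldLaw_succ (m : ℕ) {ν : Measure ℝ} [IsProbabilityMeasure ν]
    (hν : ∀ᵐ t ∂ν, 0 < t)
    {F : (SubdivEdge G m → (ℝ × ℝ) × ℝ) × (SubdivVertex G m → ℝ) → ℝ≥0∞} (hF : Measurable F) :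
    ∫⁻ p, F (pivotData m p.1 p.2, seriesField dir m p.1 p.2) ∂fieldLaw dir (m + 1) ν
      = ∫⁻ x, (∫⁻ c : SubdivVertex G m → ℝ,
          betaDensity (hMatrix (weightMatrix dir m fun a => combineSeries (x a)) c) * F (x, c))
          ∂(Measure.pi fun _ => pivotLaw ν) := by
  have hD := measurable_betaDensity_weightMatrix dir (m + 1)
    (S := (SubdivEdge G (m + 1) → ℝ) × (SubdivVertex G (m + 1) → ℝ)) measurable_fst measurable_snd
  have hF' : Measurable fun p : (SubdivEdge G (m + 1) → ℝ) × (SubdivVertex G (m + 1) → ℝ) =>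
      F (pivotData m p.1 p.2, seriesField dir m p.1 p.2) :=
    hF.comp ((measurable_pivotData m).prodMk (measurable_seriesField dir m))
  have hcomb : Measurable fun x : SubdivEdge G m → (ℝ × ℝ) × ℝ => fun a => combineSeries (x a) :=
    measurable_pi_lambda _ fun a => measurable_combineSeries.comp (measurable_pi_apply a)
  have hinner : Measurable fun p : (SubdivEdge G m → (ℝ × ℝ) × ℝ) × (SubdivVertex G m → ℝ) =>
      betaDensity (hMatrix (weightMatrix dir m fun a => combineSeries (p.1 a)) p.2) * F p :=
    (measurable_betaDensity_weightMatrix dir m (hcomb.comp measurable_fst) measurable_snd).mul hF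
  rw [fieldLaw, lintegral_withDensity_eq_lintegral_mul _ hD hF',
    lintegral_prod _ (hD.mul hF').aemeasurable,
    ← lintegral_pi_pivotDensity (edgeEquiv G m) hν hinner.lintegral_prod_right']
  exact lintegral_congr fun w => lintegral_betaDensity_weightMatrix_succ dir m w hF

/-- One step of the reduction maps the law of weights and field on the `2^(m+1)`-subdivision to
the corresponding law on the `2^m`-subdivision. -/
theorem map_fieldLaw_succ (m : ℕ) {ν : Measure ℝ} [IsProbabilityMeasure ν]
    (hν : ∀ᵐ t ∂ν, 0 < t) :
    (fieldLaw dir (m + 1) ν).map (fun p => (seriesWeight m p.1 p.2, seriesField dir m p.1 p.2))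
      = fieldLaw dir m (seriesLaw ν) := by
  have := isProbabilityMeasure_pivotLaw hν
  have := isProbabilityMeasure_seriesLaw hν
  have hcomb : Measurable fun x : SubdivEdge G m → (ℝ × ℝ) × ℝ => fun a => combineSeries (x a) :=
    measurable_pi_lambda _ fun a => measurable_combineSeries.comp (measurable_pi_apply a)
  refine Measure.ext_of_lintegral _ fun F hF => ?_
  have hD := measurable_betaDensity_weightMatrix dir m
    (S := (SubdivEdge G m → ℝ) × (SubdivVertex G m → ℝ)) measurable_fst measurable_snd
  rw [lintegral_map hF ((measurable_seriesWeight m).prodMk (measurable_seriesField dir m))]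
  have h := lintegral_fieldLaw_succ dir m hν
    (F := fun q => F (fun a => combineSeries (q.1 a), q.2))
    (hF.comp ((hcomb.comp measurable_fst).prodMk measurable_snd))
  have hpi : (Measure.pi fun _ : SubdivEdge G m => seriesLaw ν)
      = (Measure.pi fun _ : SubdivEdge G m => pivotLaw ν).map
        fun x a => combineSeries (x a) := by
    have hprob : IsProbabilityMeasure ((pivotLaw ν).map combineSeries) :=
      isProbabilityMeasure_seriesLaw hν
    exact (Measure.pi_map_pi (μ := fun _ : SubdivEdge G m => pivotLaw ν)
      (f := fun _ => combineSeries) fun _ => measurable_combineSeries.aemeasurable).symm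
  rw [show fieldLaw dir m (seriesLaw ν) = ((Measure.pi fun _ => seriesLaw ν).prod
      volume).withDensity fun p => betaDensity (hMatrix (weightMatrix dir m p.1) p.2) from rfl,
    lintegral_withDensity_eq_lintegral_mul _ hD hF,
    lintegral_prod _ (hD.mul hF).aemeasurable, hpi,
    lintegral_map (hD.mul hF).lintegral_prod_right' hcomb]
  exact h

/-- Under `fieldLaw`, the data at a single midpoint have the law `pivotLaw ν`; here the total mass
of the density of the reduced field enters. -/
theorem map_pivotData_fieldLaw (m : ℕ) {ν : Measure ℝ} [IsProbabilityMeasure ν]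
    (hν : ∀ᵐ t ∂ν, 0 < t) (a : SubdivEdge G m) :
    (fieldLaw dir (m + 1) ν).map (fun p => pivotData m p.1 p.2 a) = pivotLaw ν := by
  have := isProbabilityMeasure_pivotLaw hν
  refine Measure.ext_of_lintegral _ fun F hF => ?_
  have hmeas : Measurable fun p : (SubdivEdge G (m + 1) → ℝ) × (SubdivVertex G (m + 1) → ℝ) =>
      pivotData m p.1 p.2 a := (measurable_pi_apply a).comp (measurable_pivotData m)
  rw [lintegral_map hF hmeas]
  have h := lintegral_fieldLaw_succ dir m hν (F := fun q => F (q.1 a))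
    (hF.comp ((measurable_pi_apply a).comp measurable_fst))
  rw [h]
  have hpos : ∀ᵐ x ∂(Measure.pi fun _ : SubdivEdge G m => pivotLaw ν),
      ∀ b, 0 < combineSeries (x b) := by
    refine ae_all_iff.2 fun b => ?_
    have := (measurePreserving_eval (fun _ : SubdivEdge G m => pivotLaw ν)
      b).quasiMeasurePreserving.ae (ae_pivotLaw_pos hν)
    filter_upwards [this] with x hx using combineSeries_pos hx
  rw [← (measurePreserving_eval (fun _ : SubdivEdge G m => pivotLaw ν) a).lintegral_comp hF]
  refine lintegral_congr_ae ?_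
  filter_upwards [hpos] with x hx
  rw [lintegral_mul_const]
  · rw [lintegral_betaDensity _ (weightMatrix_isSymm dir m _)
      fun y z _ => weightMatrix_nonneg dir m (fun b => (hx b).le) y z, one_mul]
  · exact measurable_betaDensity_weightMatrix dir m measurable_const measurable_id

theorem ae_fieldLaw_posDef (m : ℕ) (ν : Measure ℝ) [IsProbabilityMeasure ν] :
    ∀ᵐ p ∂fieldLaw dir m ν, (hMatrix (weightMatrix dir m p.1) p.2).PosDef := by
  have hD := measurable_betaDensity_weightMatrix dir m
    (S := (SubdivEdge G m → ℝ) × (SubdivVertex G m → ℝ)) measurable_fst measurable_snd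
  refine (ae_withDensity_iff hD).2 (Filter.Eventually.of_forall fun p hp => ?_)
  by_contra h
  exact hp (betaDensity_of_not_posDef h)

/-- Under `fieldLaw`, every edge weight has the law `ν`. -/
theorem map_weight_fieldLaw (m : ℕ) {ν : Measure ℝ} [IsProbabilityMeasure ν]
    (hν : ∀ᵐ t ∂ν, 0 < t) (a : SubdivEdge G m) :
    (fieldLaw dir m ν).map (fun p => p.1 a) = ν := by
  have hD := measurable_betaDensity_weightMatrix dir m
    (S := (SubdivEdge G m → ℝ) × (SubdivVertex G m → ℝ)) measurable_fst measurable_snd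
  refine Measure.ext_of_lintegral _ fun F hF => ?_
  have hFa : Measurable fun p : (SubdivEdge G m → ℝ) × (SubdivVertex G m → ℝ) => F (p.1 a) :=
    hF.comp (by fun_prop)
  have hpos : ∀ᵐ w ∂(Measure.pi fun _ : SubdivEdge G m => ν), ∀ b, 0 < w b :=
    ae_all_iff.2 fun b => (measurePreserving_eval (fun _ : SubdivEdge G m => ν)
      b).quasiMeasurePreserving.ae hν
  rw [lintegral_map hF (by fun_prop), fieldLaw,
    lintegral_withDensity_eq_lintegral_mul _ hD hFa, lintegral_prod _ (hD.mul hFa).aemeasurable,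
    ← (measurePreserving_eval (fun _ : SubdivEdge G m => ν) a).lintegral_comp hF]
  refine lintegral_congr_ae ?_
  filter_upwards [hpos] with w hw
  simp only [Pi.mul_apply]
  rw [lintegral_mul_const]
  · rw [lintegral_betaDensity _ (weightMatrix_isSymm dir m _)
      fun y z _ => weightMatrix_nonneg dir m (fun b => (hw b).le) y z, one_mul]
  · exact measurable_betaDensity_weightMatrix dir m measurable_const measurable_id

end Reduction

/-! ### Effective weights as reduced weights -/

section EffectiveWeights

open Classical in
/-- Off the diagonal, the effective weights on the range of `f` are minus the entries of the inverse
of the restriction of `H_β⁻¹`. In this form, successive reductions compose. -/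
theorem effWeight_range {L Λ : Type*} [Fintype L] [Fintype Λ] [DecidableEq L] [DecidableEq Λ]
    (W : Matrix Λ Λ ℝ) (hW : W.IsSymm) (β : Λ → ℝ) (hH : (hMatrix W β).PosDef) {f : L → Λ}
    (hf : Function.Injective f) {x y : L} (hxy : x ≠ y) :
    effWeight W (Set.range f) β ⟨f x, Set.mem_range_self x⟩ ⟨f y, Set.mem_range_self y⟩
      = -((hMatrix W β)⁻¹.submatrix f f)⁻¹ x y := by
  let J := Set.range f
  let e : {z // z ∉ J} ⊕ L ≃ Λ :=
    ((Equiv.refl _).sumCongr (Equiv.ofInjective f hf)).trans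
      ((Equiv.sumComm _ _).trans (Equiv.sumCompl (· ∈ J)))
  let A := (hMatrix W β).toBlock (· ∉ J) (· ∉ J)
  let B : Matrix {z // z ∉ J} L ℝ := Matrix.of fun i z => hMatrix W β i (f z)
  have hsymm : ∀ z z', hMatrix W β z z' = hMatrix W β z' z := by
    intro z z'
    rw [hMatrix_apply, hMatrix_apply, hW.apply]
    by_cases h : z = z'
    · rw [h]
    · rw [if_neg h, if_neg (Ne.symm h)]
  have hblock : (hMatrix W β).submatrix e e
      = Matrix.fromBlocks A B B.transpose ((hMatrix W β).submatrix f f) := by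
    ext z z'
    rcases z with i | z <;> rcases z' with i' | z'
    · rfl
    · rfl
    · exact hsymm _ _
    · rfl
  have hH' : ((hMatrix W β).submatrix e e).PosDef := hH.submatrix e.injective
  have hinv : ((hMatrix W β).submatrix e e)⁻¹ = (hMatrix W β)⁻¹.submatrix e e :=
    Matrix.inv_submatrix_equiv _ _ _
  rw [hblock] at hH' hinv
  have hA : A.PosDef := hH.submatrix Subtype.val_injective
  have hS := (posDef_fromBlocks_iff B _ hA).1 hH'
  have h1 := toBlocks₂₂_inv_fromBlocks B _ hA hH'
  rw [hinv] at h1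
  have h2 : (hMatrix W β)⁻¹.submatrix f f
      = ((hMatrix W β).submatrix f f - B.transpose * A⁻¹ * B)⁻¹ := h1
  rw [h2, Matrix.nonsing_inv_nonsing_inv _ ((Matrix.isUnit_iff_isUnit_det _).1 hS.isUnit)]
  have hB : ∀ (i : {z // z ∉ J}) (z : L), B i z = -W i (f z) := by
    intro i z
    have hne : (i : Λ) ≠ f z := fun h => i.2 ⟨z, h.symm⟩
    simp only [B, Matrix.of_apply, hMatrix_apply, if_neg hne, zero_sub]
  rw [Matrix.sub_apply, Matrix.submatrix_apply, hMatrix_apply, if_neg fun h => hxy (hf h)]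
  unfold effWeight
  rw [Matrix.add_apply, zero_sub, neg_sub, sub_neg_eq_add, add_comm]
  congr 1
  simp only [Matrix.mul_apply, Matrix.transpose_apply, hB, Matrix.toBlock_apply]
  refine Finset.sum_congr (by ext; simp) fun i _ => ?_
  rw [mul_neg, ← neg_mul]
  congr 1
  rw [← Finset.sum_neg_distrib]
  refine Finset.sum_congr (by ext; simp) fun i' _ => ?_
  rw [neg_mul, neg_neg, hW.apply]
  congr!

variable {V : Type*} [Fintype V] [DecidableEq V] {G : SimpleGraph V} [DecidableRel G.Adj]
  (dir : G.edgeSet → G.Dart) {Ω : Type*} [MeasurableSpace Ω] {P : Measure Ω}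

/-- Effective weights are determined by the restriction of `H_β⁻¹`: if it is the inverse of a matrix
`H` on the smaller subdivision, the weights of that matrix are the effective weights. -/
theorem effEdgeWeight_eq (hdir : ∀ e, (dir e).edge = e) {l r : ℕ} (h : l ≤ r)
    {w : SubdivEdge G r → ℝ} {β : SubdivVertex G r → ℝ} {w' : SubdivEdge G l → ℝ}
    {β' : SubdivVertex G l → ℝ} (hH : (hMatrix (weightMatrix dir r w) β).PosDef)
    (hH' : (hMatrix (weightMatrix dir l w') β').PosDef)
    (hinv : (hMatrix (weightMatrix dir l w') β')⁻¹
      = (hMatrix (weightMatrix dir r w) β)⁻¹.submatrix (subdivIncl h) (subdivIncl h))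
    (a : SubdivEdge G l) : effEdgeWeight dir h w β a = w' a := by
  have hne := edgeFst_ne_edgeSnd dir l a
  have h1 := effWeight_range _ (weightMatrix_isSymm dir r w) β hH (subdivIncl_injective h) hne
  rw [← hinv, Matrix.nonsing_inv_nonsing_inv _ ((Matrix.isUnit_iff_isUnit_det _).1 hH'.isUnit),
    hMatrix_apply, if_neg hne, weightMatrix_edge dir hdir] at h1
  rw [← neg_neg (w' a), ← zero_sub (w' a)]
  exact h1

/-- The joint law of i.i.d. weights and a field with the prescribed conditional law. -/
theorem map_prodMk_eq_fieldLaw [IsProbabilityMeasure P] {r : ℕ} {W : Ω → SubdivEdge G r → ℝ}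
    (hW : Measurable W) {β : Ω → SubdivVertex G r → ℝ} (hβm : Measurable β)
    (hβ : IsCondLaw P β W fun w => betaLaw (weightMatrix dir r w)) {ν : Measure ℝ}
    [IsProbabilityMeasure ν] (hν : P.map W = Measure.pi fun _ => ν) :
    P.map (fun ω => (W ω, β ω)) = fieldLaw dir r ν := by
  have hm : Measurable fun ω => (W ω, β ω) := hW.prodMk hβm
  have : IsProbabilityMeasure (P.map fun ω => (W ω, β ω)) :=
    Measure.isProbabilityMeasure_map hm.aemeasurable
  have hD := measurable_betaDensity_weightMatrix dir r
    (S := (SubdivEdge G r → ℝ) × (SubdivVertex G r → ℝ)) measurable_fst measurable_snd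
  refine Measure.ext_prod fun {A B} hA hB => ?_
  have hlaw : ∀ w : SubdivEdge G r → ℝ, betaLaw (weightMatrix dir r w) B
      = ∫⁻ b in B, betaDensity (hMatrix (weightMatrix dir r w) b) := by
    intro w
    rw [betaLaw_eq_withDensity, withDensity_apply _ hB]
  rw [Measure.map_apply hm (hA.prod hB), fieldLaw, withDensity_apply _ (hA.prod hB),
    ← Measure.prod_restrict, lintegral_prod _ hD.aemeasurable, ← hν,
    setLIntegral_map hA hD.lintegral_prod_right' hW]
  rw [Set.mk_preimage_prod, hβ A hA B hB]
  simp only [hlaw]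

/-- The reduction from the `2^r`- to the `2^l`-subdivision: there are weights and a field on the
latter with a law of the same type, such that inverting `H` commutes with restriction. -/
theorem exists_reduced_field {l r : ℕ} (hlr : l ≤ r) {W : Ω → SubdivEdge G r → ℝ}
    (hW : Measurable W) {β : Ω → SubdivVertex G r → ℝ} (hβ : Measurable β) {ν : Measure ℝ}
    [IsProbabilityMeasure ν] (hν : ∀ᵐ t ∂ν, 0 < t)
    (hlaw : P.map (fun ω => (W ω, β ω)) = fieldLaw dir r ν) :
    ∃ ν' : Measure ℝ, IsProbabilityMeasure ν' ∧ (∀ᵐ t ∂ν', 0 < t) ∧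
      ∃ (T : Ω → SubdivEdge G l → ℝ) (β' : Ω → SubdivVertex G l → ℝ),
        Measurable T ∧ Measurable β' ∧ P.map (fun ω => (T ω, β' ω)) = fieldLaw dir l ν' ∧
        ∀ᵐ ω ∂P, (hMatrix (weightMatrix dir l (T ω)) (β' ω))⁻¹
          = (hMatrix (weightMatrix dir r (W ω)) (β ω))⁻¹.submatrix (subdivIncl hlr)
              (subdivIncl hlr) := by
  induction hlr using Nat.decreasingInduction with
  | self =>
    refine ⟨ν, inferInstance, hν, W, β, hW, hβ, hlaw, Filter.Eventually.of_forall fun ω => ?_⟩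
    ext x y
    rw [Matrix.submatrix_apply, subdivIncl_self, subdivIncl_self]
  | of_succ m hm ih =>
    obtain ⟨ν', hprob, hpos, T, β', hT, hβ', hlaw', hinv⟩ := ih
    refine ⟨seriesLaw ν', isProbabilityMeasure_seriesLaw hpos, ae_seriesLaw_pos hpos,
      fun ω => seriesWeight m (T ω) (β' ω), fun ω => seriesField dir m (T ω) (β' ω),
      (measurable_seriesWeight m).comp (hT.prodMk hβ'),
      (measurable_seriesField dir m).comp (hT.prodMk hβ'), ?_, ?_⟩
    · rw [← map_fieldLaw_succ dir m hpos, ← hlaw', Measure.map_map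
        ((measurable_seriesWeight m).prodMk (measurable_seriesField dir m)) (hT.prodMk hβ')]
      rfl
    · have hpd : ∀ᵐ ω ∂P, (hMatrix (weightMatrix dir (m + 1) (T ω)) (β' ω)).PosDef :=
        ae_of_ae_map (hT.prodMk hβ').aemeasurable
          (p := fun p => (hMatrix (weightMatrix dir (m + 1) p.1) p.2).PosDef)
          (hlaw' ▸ ae_fieldLaw_posDef dir (m + 1) ν')
      filter_upwards [hpd, hinv] with ω h1 h2
      rw [← hMatrix_reducedMatrix_weightMatrix, inv_hMatrix_reducedMatrix _
        (weightMatrix_isSymm dir (m + 1) _) _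
        (fun i i' _ => weightMatrix_succ_inl_inl dir m _ i i') _ h1, h2]
      ext x y
      simp only [Matrix.submatrix_apply]
      rw [← subdivIncl_comp (Nat.le_succ m) hm x, ← subdivIncl_comp (Nat.le_succ m) hm y]
      rfl

/-- The effective weights on two successive levels: those on the `2^(m+1)`-subdivision have a common
law `ν`, and each one on the `2^m`-subdivision is the weight of two edges in series, where the two
weights are independent with law `ν`. -/
theorem exists_pivot_data [IsProbabilityMeasure P] (hdir : ∀ e, (dir e).edge = e) {m r : ℕ}
    (hm : m ≤ r) (hm1 : m + 1 ≤ r) {W : Ω → SubdivEdge G r → ℝ}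
    (hW : Measurable W) {β : Ω → SubdivVertex G r → ℝ} (hβm : Measurable β)
    (hβ : IsCondLaw P β W fun w => betaLaw (weightMatrix dir r w)) {ν : Measure ℝ}
    [IsProbabilityMeasure ν] (hν : ∀ᵐ t ∂ν, 0 < t) (hWν : P.map W = Measure.pi fun _ => ν) :
    ∃ ν' : Measure ℝ, IsProbabilityMeasure ν' ∧ (∀ᵐ t ∂ν', 0 < t) ∧
      (∀ b, ∃ X : Ω → ℝ, Measurable X ∧ P.map X = ν' ∧
        ∀ᵐ ω ∂P, effEdgeWeight dir hm1 (W ω) (β ω) b = X ω) ∧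
      ∀ a, ∃ X : Ω → (ℝ × ℝ) × ℝ, Measurable X ∧ P.map X = pivotLaw ν' ∧
        ∀ᵐ ω ∂P, effEdgeWeight dir hm (W ω) (β ω) a = combineSeries (X ω) := by
  have hlaw := map_prodMk_eq_fieldLaw dir hW hβm hβ hWν
  obtain ⟨ν', hprob, hpos, T, β', hT, hβ', hlaw', hinv⟩ :=
    exists_reduced_field dir hm1 hW hβm hν hlaw
  have hpd : ∀ᵐ ω ∂P, (hMatrix (weightMatrix dir r (W ω)) (β ω)).PosDef :=
    ae_of_ae_map (hW.prodMk hβm).aemeasurable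
      (p := fun p => (hMatrix (weightMatrix dir r p.1) p.2).PosDef)
      (hlaw ▸ ae_fieldLaw_posDef dir r ν)
  have hpd' : ∀ᵐ ω ∂P, (hMatrix (weightMatrix dir (m + 1) (T ω)) (β' ω)).PosDef :=
    ae_of_ae_map (hT.prodMk hβ').aemeasurable
      (p := fun p => (hMatrix (weightMatrix dir (m + 1) p.1) p.2).PosDef)
      (hlaw' ▸ ae_fieldLaw_posDef dir (m + 1) ν')
  refine ⟨ν', hprob, hpos, fun b => ⟨fun ω => T ω b, (measurable_pi_apply b).comp hT, ?_, ?_⟩,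
    fun a => ⟨fun ω => pivotData m (T ω) (β' ω) a, ?_, ?_, ?_⟩⟩
  · rw [← map_weight_fieldLaw dir (m + 1) hpos b, ← hlaw',
      Measure.map_map (by fun_prop) (hT.prodMk hβ')]
    rfl
  · filter_upwards [hpd, hpd', hinv] with ω h1 h2 h3
    exact effEdgeWeight_eq dir hdir hm1 h1 h2 h3 b
  · exact (measurable_pi_apply a).comp ((measurable_pivotData m).comp (hT.prodMk hβ'))
  · have hmeas : Measurable fun p : (SubdivEdge G (m + 1) → ℝ) × (SubdivVertex G (m + 1) → ℝ) =>
        pivotData m p.1 p.2 a := (measurable_pi_apply a).comp (measurable_pivotData m)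
    rw [← map_pivotData_fieldLaw dir m hpos a, ← hlaw', Measure.map_map hmeas (hT.prodMk hβ')]
    rfl
  · filter_upwards [hpd, hpd', hinv] with ω h1 h2 h3
    have hinv' := inv_hMatrix_reducedMatrix _ (weightMatrix_isSymm dir (m + 1) (T ω))
      (vertexEquiv G m) (fun i i' _ => weightMatrix_succ_inl_inl dir m _ i i') _ h2
    have hpd0 : (hMatrix (weightMatrix dir m (seriesWeight m (T ω) (β' ω)))
        (seriesField dir m (T ω) (β' ω))).PosDef := by
      rw [← hMatrix_reducedMatrix_weightMatrix, ← Matrix.posDef_inv_iff, hinv']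
      exact h2.inv.submatrix fun x y hxy => by simpa using hxy
    refine effEdgeWeight_eq dir hdir hm h1 hpd0 ?_ a
    rw [← hMatrix_reducedMatrix_weightMatrix, hinv', h3]
    ext x y
    simp only [Matrix.submatrix_apply]
    rw [← subdivIncl_comp (Nat.le_succ m) hm1 x, ← subdivIncl_comp (Nat.le_succ m) hm1 y]
    rfl

end EffectiveWeights

/-! ### Moments of the weight of two edges in series -/

section Moments

variable {ν : Measure ℝ} [IsProbabilityMeasure ν]

theorem lintegral_pivotLaw_fst (hν : ∀ᵐ t ∂ν, 0 < t) {F : ℝ × ℝ → ℝ≥0∞} (hF : Measurable F) :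
    ∫⁻ p, F p.1 ∂pivotLaw ν = ∫⁻ q, F q ∂(ν.prod ν) := by
  rw [lintegral_pivotLaw (F := fun p => F p.1) (hF.comp measurable_fst)]
  refine lintegral_congr_ae ?_
  filter_upwards [ae_prod_pos hν] with q hq
  have hm : Measurable fun b : ℝ => pivotDensity (q.1 + q.2) (2 * b) :=
    measurable_pivotDensity.comp (measurable_const.prodMk (by fun_prop))
  rw [lintegral_mul_const _ hm, lintegral_pivotDensity (add_pos hq.1 hq.2).le, one_mul]

theorem map_fst_pivotLaw (hν : ∀ᵐ t ∂ν, 0 < t) : (pivotLaw ν).map Prod.fst = ν.prod ν :=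
  Measure.ext_of_lintegral _ fun F hF => by
    rw [lintegral_map hF measurable_fst, lintegral_pivotLaw_fst hν hF]

theorem measurePreserving_pivotLaw_fst_fst (hν : ∀ᵐ t ∂ν, 0 < t) :
    MeasurePreserving (fun p : (ℝ × ℝ) × ℝ => p.1.1) (pivotLaw ν) ν :=
  measurePreserving_fst.comp ⟨measurable_fst, map_fst_pivotLaw hν⟩

theorem measurePreserving_pivotLaw_fst_snd (hν : ∀ᵐ t ∂ν, 0 < t) :
    MeasurePreserving (fun p : (ℝ × ℝ) × ℝ => p.1.2) (pivotLaw ν) ν :=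
  measurePreserving_snd.comp ⟨measurable_fst, map_fst_pivotLaw hν⟩

theorem lintegral_pivotLaw_mul_div (hν : ∀ᵐ t ∂ν, 0 < t) {F : ℝ × ℝ → ℝ≥0∞}
    (hF : Measurable F) :
    ∫⁻ p, F p.1 * ENNReal.ofReal ((p.1.1 + p.1.2) / (2 * p.2)) ∂pivotLaw ν
      = ∫⁻ q, F q ∂(ν.prod ν) := by
  rw [lintegral_pivotLaw
    (F := fun p => F p.1 * ENNReal.ofReal ((p.1.1 + p.1.2) / (2 * p.2)))
    ((hF.comp measurable_fst).mul (by fun_prop))]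
  refine lintegral_congr_ae ?_
  filter_upwards [ae_prod_pos hν] with q hq
  have hm : Measurable fun b : ℝ => pivotDensity (q.1 + q.2) (2 * b) :=
    measurable_pivotDensity.comp (measurable_const.prodMk (by fun_prop))
  have hm' : Measurable fun b : ℝ =>
      pivotDensity (q.1 + q.2) (2 * b) * ENNReal.ofReal ((q.1 + q.2) / (2 * b)) :=
    hm.mul (by fun_prop)
  simp only [mul_left_comm _ (F q)]
  rw [lintegral_const_mul _ hm',
    lintegral_pivotDensity_mul_div (add_pos hq.1 hq.2), mul_one]

theorem lintegral_pivotLaw_mul_rpow_le (hν : ∀ᵐ t ∂ν, 0 < t) {F : ℝ × ℝ → ℝ≥0∞}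
    (hF : Measurable F) {α : ℝ} (hα0 : 0 ≤ α) (hα : α < 1 / 2) :
    ∫⁻ p, F p.1 * ENNReal.ofReal ((2 * p.2) ^ (-α)) ∂pivotLaw ν
      ≤ ENNReal.ofReal (cAlpha α) * ∫⁻ q, F q ∂(ν.prod ν) := by
  rw [lintegral_pivotLaw (F := fun p => F p.1 * ENNReal.ofReal ((2 * p.2) ^ (-α)))
    ((hF.comp measurable_fst).mul (by fun_prop)), ← lintegral_const_mul _ hF]
  refine lintegral_mono_ae ?_
  filter_upwards [ae_prod_pos hν] with q hq
  have hm : Measurable fun b : ℝ => pivotDensity (q.1 + q.2) (2 * b) :=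
    measurable_pivotDensity.comp (measurable_const.prodMk (by fun_prop))
  have hm' : Measurable fun b : ℝ =>
      pivotDensity (q.1 + q.2) (2 * b) * ENNReal.ofReal ((2 * b) ^ (-α)) :=
    hm.mul (by fun_prop)
  simp only [mul_left_comm _ (F q)]
  rw [lintegral_const_mul _ hm', mul_comm]
  exact mul_le_mul_left (lintegral_pivotDensity_mul_rpow_le (add_pos hq.1 hq.2) hα0 hα) _

theorem lintegral_pivotLaw_sq (hν : ∀ᵐ t ∂ν, 0 < t) :
    ∫⁻ p, ENNReal.ofReal (2 * p.2 + (p.1.1 + p.1.2) ^ 2 / (2 * p.2) - 2 * (p.1.1 + p.1.2))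
      ∂pivotLaw ν = 1 := by
  rw [lintegral_pivotLaw (by fun_prop), lintegral_congr_ae (g := fun _ => 1)]
  · simp
  · filter_upwards [ae_prod_pos hν] with q hq
    exact lintegral_pivotDensity_mul_sq (add_pos hq.1 hq.2).le

theorem posExp_eq_of_map {Ω S : Type*} [MeasurableSpace Ω] [MeasurableSpace S] {P : Measure Ω}
    {μ : Measure S} {X : Ω → S} (hX : Measurable X) (hμ : P.map X = μ) {Z : Ω → ℝ} {f : S → ℝ}
    (hf : Measurable f) (hZ : ∀ᵐ ω ∂P, Z ω = f (X ω)) : posExp P Z = posExp μ f := by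
  unfold posExp
  rw [← hμ, lintegral_map (by fun_prop) hX]
  refine lintegral_congr_ae ?_
  filter_upwards [hZ] with ω hω
  rw [hω]

/-- Half of the harmonic mean is at most half of the geometric mean, whose `α`-th power is at most
the mean of the `α`-th powers. -/
theorem mul_div_add_rpow_le {s t α : ℝ} (hs : 0 < s) (ht : 0 < t) (hα : 0 ≤ α) :
    (s * t / (s + t)) ^ α ≤ 2 ^ (-α) * ((s ^ α + t ^ α) / 2) := by
  have h1 : s * t / (s + t) ≤ 2⁻¹ * (Real.sqrt s * Real.sqrt t) := by
    have hs2 := Real.sq_sqrt hs.le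
    have ht2 := Real.sq_sqrt ht.le
    have hs3 := Real.sqrt_pos.2 hs
    have ht3 := Real.sqrt_pos.2 ht
    set u := Real.sqrt s
    set v := Real.sqrt t
    rw [div_le_iff₀ (by positivity), ← hs2, ← ht2]
    nlinarith [mul_pos hs3 ht3, mul_nonneg (mul_pos hs3 ht3).le (sq_nonneg (u - v))]
  have h2 : Real.sqrt s ^ α * Real.sqrt t ^ α ≤ (s ^ α + t ^ α) / 2 := by
    have e : ∀ x : ℝ, 0 < x → x ^ α = (Real.sqrt x ^ α) ^ 2 := fun x hx => by
      rw [← Real.rpow_natCast, ← Real.rpow_mul (Real.sqrt_nonneg x), mul_comm α,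
        Real.rpow_mul (Real.sqrt_nonneg x), Real.rpow_natCast, Real.sq_sqrt hx.le]
    rw [e s hs, e t ht]
    nlinarith [sq_nonneg (Real.sqrt s ^ α - Real.sqrt t ^ α)]
  calc (s * t / (s + t)) ^ α ≤ (2⁻¹ * (Real.sqrt s * Real.sqrt t)) ^ α :=
        Real.rpow_le_rpow (by positivity) h1 hα
    _ = 2 ^ (-α) * (Real.sqrt s ^ α * Real.sqrt t ^ α) := by
        rw [Real.mul_rpow (by positivity) (by positivity),
          Real.mul_rpow (by positivity) (by positivity), Real.inv_rpow (by norm_num),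
          ← Real.rpow_neg (by norm_num)]
    _ ≤ _ := mul_le_mul_of_nonneg_left h2 (by positivity)

/-- The first moment bound: a conditional Jensen inequality, in the form of Bernoulli's inequality
for the pivot, followed by the comparison of harmonic and geometric mean. -/
theorem posExp_combineSeries_rpow_le (hν : ∀ᵐ t ∂ν, 0 < t) {α : ℝ} (hα0 : 0 ≤ α)
    (hα1 : α ≤ 1) :
    posExp (pivotLaw ν) (fun p => combineSeries p ^ α)
      ≤ ENNReal.ofReal (2 ^ (-α)) * posExp ν (fun t => t ^ α) := by
  set G : ℝ × ℝ → ℝ≥0∞ := fun q => ENNReal.ofReal ((q.1 * q.2 / (q.1 + q.2)) ^ α) with hG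
  have hGm : Measurable G := by fun_prop
  have h1 : posExp (pivotLaw ν) (fun p => combineSeries p ^ α) ≤ ∫⁻ q, G q ∂(ν.prod ν) := by
    calc posExp (pivotLaw ν) (fun p => combineSeries p ^ α)
        ≤ ∫⁻ p, (ENNReal.ofReal (1 - α) * G p.1 + ENNReal.ofReal α
            * (G p.1 * ENNReal.ofReal ((p.1.1 + p.1.2) / (2 * p.2)))) ∂pivotLaw ν := by
          refine lintegral_mono_ae ?_
          filter_upwards [ae_pivotLaw_pos hν] with p hp
          obtain ⟨⟨hs, ht⟩, hb⟩ := hp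
          set x := (p.1.1 + p.1.2) / (2 * p.2) with hx
          have hx0 : 0 < x := by positivity
          have hsplit : combineSeries p = p.1.1 * p.1.2 / (p.1.1 + p.1.2) * x := by
            rw [hx, combineSeries]
            field_simp
          have hbern : x ^ α ≤ 1 - α + α * x := by
            have := rpow_one_add_le_one_add_mul_self (s := x - 1) (p := α) (by linarith) hα0 hα1
            rw [add_sub_cancel] at this
            linarith
          have hα1' : 0 ≤ 1 - α := by linarith
          simp only [hG]
          rw [← ENNReal.ofReal_mul hα1', ← ENNReal.ofReal_mul (by positivity),
            ← ENNReal.ofReal_mul hα0, ← ENNReal.ofReal_add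
              (mul_nonneg (by linarith) (by positivity)) (by positivity), hsplit,
            Real.mul_rpow (by positivity) hx0.le]
          refine ENNReal.ofReal_le_ofReal ?_
          have := mul_le_mul_of_nonneg_left hbern
            (by positivity : 0 ≤ (p.1.1 * p.1.2 / (p.1.1 + p.1.2)) ^ α)
          linarith
      _ = ∫⁻ q, G q ∂(ν.prod ν) := by
          have hm : Measurable fun p : (ℝ × ℝ) × ℝ =>
              G p.1 * ENNReal.ofReal ((p.1.1 + p.1.2) / (2 * p.2)) :=
            (hGm.comp measurable_fst).mul (by fun_prop)
          have hm1 : Measurable fun p : (ℝ × ℝ) × ℝ => G p.1 := hGm.comp measurable_fst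
          rw [lintegral_add_right _ (hm.const_mul _), lintegral_const_mul _ hm,
            lintegral_const_mul _ hm1, lintegral_pivotLaw_mul_div hν hGm,
            lintegral_pivotLaw_fst hν hGm, ← add_mul, ← ENNReal.ofReal_add (by linarith) hα0]
          simp
  refine h1.trans ?_
  have hm : Measurable fun t : ℝ => ENNReal.ofReal (t ^ α) := by fun_prop
  calc ∫⁻ q, G q ∂(ν.prod ν)
      ≤ ∫⁻ q, ENNReal.ofReal (2 ^ (-α)) * (ENNReal.ofReal 2⁻¹
          * (ENNReal.ofReal (q.1 ^ α) + ENNReal.ofReal (q.2 ^ α))) ∂(ν.prod ν) := by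
        refine lintegral_mono_ae ?_
        filter_upwards [ae_prod_pos hν] with q hq
        obtain ⟨hs, ht⟩ := hq
        rw [← ENNReal.ofReal_add (by positivity) (by positivity),
          ← ENNReal.ofReal_mul (by positivity), ← ENNReal.ofReal_mul (by positivity)]
        refine ENNReal.ofReal_le_ofReal ?_
        have := mul_div_add_rpow_le hs ht hα0
        rwa [div_eq_inv_mul (q.1 ^ α + q.2 ^ α)] at this
    _ = ENNReal.ofReal (2 ^ (-α)) * posExp ν (fun t => t ^ α) := by
        rw [lintegral_const_mul _ (by fun_prop), lintegral_const_mul _ (by fun_prop),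
          lintegral_add_left (by fun_prop),
          measurePreserving_fst.lintegral_comp (f := fun t => ENNReal.ofReal (t ^ α)) hm,
          measurePreserving_snd.lintegral_comp (f := fun t => ENNReal.ofReal (t ^ α)) hm,
          ← two_mul, ← mul_assoc (ENNReal.ofReal 2⁻¹),
          show (2 : ℝ≥0∞) = ENNReal.ofReal 2 by simp, ← ENNReal.ofReal_mul (by positivity)]
        simp [posExp]

/-- The second moment bound: the two weights are independent, and negative moments of the pivot
are at most those for the parameter `η = 0`. -/
theorem posExp_combineSeries_rpow_le_sq (hν : ∀ᵐ t ∂ν, 0 < t) {α : ℝ} (hα0 : 0 ≤ α)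
    (hα : α < 1 / 2) :
    posExp (pivotLaw ν) (fun p => combineSeries p ^ α)
      ≤ ENNReal.ofReal (cAlpha α) * posExp ν (fun t => t ^ α) ^ 2 := by
  have hm : Measurable fun t : ℝ => ENNReal.ofReal (t ^ α) := by fun_prop
  have h := lintegral_pivotLaw_mul_rpow_le hν
    (F := fun q => ENNReal.ofReal (q.1 ^ α) * ENNReal.ofReal (q.2 ^ α)) (by fun_prop) hα0 hα
  rw [lintegral_prod_mul hm.aemeasurable hm.aemeasurable, ← sq] at h
  refine le_trans (le_of_eq ?_) h
  refine lintegral_congr_ae ?_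
  filter_upwards [ae_pivotLaw_pos hν] with p hp
  obtain ⟨⟨hs, ht⟩, hb⟩ := hp
  rw [← ENNReal.ofReal_mul (by positivity), ← ENNReal.ofReal_mul (by positivity), combineSeries,
    Real.div_rpow (by positivity) hb.le, Real.mul_rpow hs.le ht.le, Real.rpow_neg hb.le,
    div_eq_mul_inv]

end Moments

/-! ### Logarithmic moments -/

section Logarithm

theorem integrable_of_posExp {S : Type*} [MeasurableSpace S] {μ : Measure S} {f : S → ℝ}
    (hf : Measurable f) (h1 : posExp μ f ≠ ∞) (h2 : posExp μ (fun x => -f x) ≠ ∞) :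
    Integrable f μ := by
  refine ⟨hf.aestronglyMeasurable, ?_⟩
  rw [hasFiniteIntegral_iff_enorm]
  have : ∀ x, ‖f x‖ₑ ≤ ENNReal.ofReal (f x) + ENNReal.ofReal (-f x) := fun x => by
    rw [Real.enorm_eq_ofReal_abs]
    rcases le_total 0 (f x) with h | h
    · rw [abs_of_nonneg h]
      exact le_self_add
    · rw [abs_of_nonpos h]
      exact le_add_self
  refine (lintegral_mono this).trans_lt ?_
  rw [lintegral_add_left (by fun_prop)]
  exact ENNReal.add_lt_top.2 ⟨h1.lt_top, h2.lt_top⟩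

theorem extExp_eq_integral {S : Type*} [MeasurableSpace S] {μ : Measure S} {f : S → ℝ}
    (hf : Measurable f) (h1 : posExp μ f ≠ ∞) (h2 : posExp μ (fun x => -f x) ≠ ∞) :
    extExp μ f = ((∫ x, f x ∂μ : ℝ) : EReal) := by
  rw [integral_eq_lintegral_pos_part_sub_lintegral_neg_part (integrable_of_posExp hf h1 h2),
    EReal.coe_sub]
  exact congrArg₂ (· - ·) (EReal.coe_ennreal_toReal h1).symm (EReal.coe_ennreal_toReal h2).symm

/-- The origin of the constant `c₂`: it is the derivative of `α ↦ C_α` at `0`. -/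
theorem hasDerivAt_cAlpha_zero : HasDerivAt cAlpha cTwo 0 := by
  have hΓ : HasDerivAt (fun α : ℝ => Real.Gamma (1 / 2 - α))
      (-(-Real.sqrt Real.pi * (Real.eulerMascheroniConstant + 2 * Real.log 2))) 0 := by
    have h1 : HasDerivAt (fun α : ℝ => 1 / 2 - α) (-1) 0 := by
      exact (hasDerivAt_id (0 : ℝ)).const_sub (1 / 2)
    have h2 : HasDerivAt Real.Gamma
        (-Real.sqrt Real.pi * (Real.eulerMascheroniConstant + 2 * Real.log 2)) (1 / 2 - 0) := by
      rw [sub_zero]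
      exact Real.hasDerivAt_Gamma_one_half
    exact (h2.comp (0 : ℝ) h1).congr_deriv (by ring)
  have hpow : HasDerivAt (fun α : ℝ => (2 : ℝ) ^ (-α)) (-Real.log 2) 0 := by
    have := (hasDerivAt_neg (0 : ℝ)).const_rpow (a := 2) (by norm_num)
    exact this.congr_deriv (by simp)
  have h := (hpow.mul hΓ).div_const (Real.sqrt Real.pi)
  refine h.congr_deriv ?_
  have hpi : Real.sqrt Real.pi ≠ 0 := (Real.sqrt_pos.2 Real.pi_pos).ne'
  rw [neg_zero, Real.rpow_zero, sub_zero, Real.Gamma_one_half_eq, cTwo]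
  field_simp
  ring

variable {ν : Measure ℝ} [IsProbabilityMeasure ν]

theorem lintegral_pivotLaw_div (hν : ∀ᵐ t ∂ν, 0 < t) :
    ∫⁻ p, ENNReal.ofReal ((p.1.1 + p.1.2) / (2 * p.2)) ∂pivotLaw ν = 1 := by
  have h := lintegral_pivotLaw_mul_div hν (F := fun _ => 1) measurable_const
  simpa using h

theorem measurable_log_combineSeries : Measurable fun p => Real.log (combineSeries p) :=
  Real.measurable_log.comp measurable_combineSeries

/-- The logarithm of `t₁ t₂ / s` is bounded by that of `t₁ t₂ / (t₁ + t₂)`, up to an error which has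
mean zero under the law of the pivot `s`. -/
theorem log_combineSeries_le {p : (ℝ × ℝ) × ℝ} (hp : (0 < p.1.1 ∧ 0 < p.1.2) ∧ 0 < 2 * p.2) :
    Real.log (combineSeries p) ≤ Real.log (p.1.1 * p.1.2 / (p.1.1 + p.1.2))
      + ((p.1.1 + p.1.2) / (2 * p.2) - 1) := by
  obtain ⟨⟨hs, ht⟩, hb⟩ := hp
  have hsplit : combineSeries p
      = p.1.1 * p.1.2 / (p.1.1 + p.1.2) * ((p.1.1 + p.1.2) / (2 * p.2)) := by
    rw [combineSeries]
    field_simp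
  rw [hsplit, Real.log_mul (by positivity) (by positivity)]
  have := Real.log_le_sub_one_of_pos (x := (p.1.1 + p.1.2) / (2 * p.2)) (by positivity)
  linarith

theorem log_combineSeries_le_log_fst {p : (ℝ × ℝ) × ℝ}
    (hp : (0 < p.1.1 ∧ 0 < p.1.2) ∧ 0 < 2 * p.2) :
    Real.log (combineSeries p) ≤ Real.log p.1.1 + (p.1.1 + p.1.2) / (2 * p.2) := by
  have h := log_combineSeries_le hp
  obtain ⟨⟨hs, ht⟩, hb⟩ := hp
  have : Real.log (p.1.1 * p.1.2 / (p.1.1 + p.1.2)) ≤ Real.log p.1.1 := by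
    refine Real.log_le_log (by positivity) ?_
    rw [div_le_iff₀ (by positivity)]
    nlinarith
  linarith

theorem posExp_log_combineSeries_ne_top (hν : ∀ᵐ t ∂ν, 0 < t) (h : posExp ν Real.log ≠ ∞) :
    posExp (pivotLaw ν) (fun p => Real.log (combineSeries p)) ≠ ∞ := by
  have hle : posExp (pivotLaw ν) (fun p => Real.log (combineSeries p))
      ≤ ∫⁻ p, (ENNReal.ofReal (Real.log p.1.1)
        + ENNReal.ofReal ((p.1.1 + p.1.2) / (2 * p.2))) ∂pivotLaw ν := by
    refine lintegral_mono_ae ?_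
    filter_upwards [ae_pivotLaw_pos hν] with p hp
    exact (ENNReal.ofReal_le_ofReal (log_combineSeries_le_log_fst hp)).trans
      ENNReal.ofReal_add_le
  rw [lintegral_add_left (by fun_prop), lintegral_pivotLaw_div hν,
    (measurePreserving_pivotLaw_fst_fst hν).lintegral_comp
      (f := fun t => ENNReal.ofReal (Real.log t)) (by fun_prop)] at hle
  exact ne_top_of_le_ne_top (ENNReal.add_ne_top.2 ⟨h, ENNReal.one_ne_top⟩) hle

theorem posExp_neg_log_combineSeries_eq_top (hν : ∀ᵐ t ∂ν, 0 < t)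
    (h : posExp ν (fun t => -Real.log t) = ∞) :
    posExp (pivotLaw ν) (fun p => -Real.log (combineSeries p)) = ∞ := by
  have hle : ∫⁻ p, ENNReal.ofReal (-Real.log p.1.1) ∂pivotLaw ν
      ≤ ∫⁻ p, (ENNReal.ofReal (-Real.log (combineSeries p))
        + ENNReal.ofReal ((p.1.1 + p.1.2) / (2 * p.2))) ∂pivotLaw ν := by
    refine lintegral_mono_ae ?_
    filter_upwards [ae_pivotLaw_pos hν] with p hp
    refine le_trans (ENNReal.ofReal_le_ofReal ?_) ENNReal.ofReal_add_le
    linarith [log_combineSeries_le_log_fst hp]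
  rw [lintegral_add_right _ (by fun_prop), lintegral_pivotLaw_div hν,
    (measurePreserving_pivotLaw_fst_fst hν).lintegral_comp
      (f := fun t => ENNReal.ofReal (-Real.log t)) (by fun_prop)] at hle
  have h' : ∫⁻ t, ENNReal.ofReal (-Real.log t) ∂ν = ∞ := h
  rw [h', top_le_iff, ENNReal.add_eq_top] at hle
  exact hle.resolve_right ENNReal.one_ne_top

/-- For the pivot `s = 2 p.2` and `η = p.1.1 + p.1.2`, the variable `y = √s - η / √s` has unit
second moment, and `s ≤ y² + 2 η`. This bounds `log (s / (t₁ t₂))` by `y²` and the negative parts of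
`log t₁` and `log t₂`, without integrability of their positive parts. -/
theorem neg_log_combineSeries_le {p : (ℝ × ℝ) × ℝ}
    (hp : (0 < p.1.1 ∧ 0 < p.1.2) ∧ 0 < 2 * p.2) :
    -Real.log (combineSeries p) ≤ max 0 (-Real.log p.1.1) + max 0 (-Real.log p.1.2)
      + ((2 * p.2 + (p.1.1 + p.1.2) ^ 2 / (2 * p.2) - 2 * (p.1.1 + p.1.2)) + 3) := by
  obtain ⟨⟨hs, ht⟩, hb⟩ := hp
  set s := p.1.1
  set t := p.1.2
  set b := 2 * p.2 with hbdef
  have hy : 0 ≤ b + (s + t) ^ 2 / b - 2 * (s + t) := by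
    have : b + (s + t) ^ 2 / b - 2 * (s + t) = (b - (s + t)) ^ 2 / b := by field_simp; ring
    rw [this]
    positivity
  have hb1 : b ≤ (b + (s + t) ^ 2 / b - 2 * (s + t)) + 2 * (s + t) := by
    have : 0 ≤ (s + t) ^ 2 / b := by positivity
    linarith
  set y := b + (s + t) ^ 2 / b - 2 * (s + t)
  have hexp : ∀ x : ℝ, 0 < x → 1 ≤ Real.exp (max 0 (-Real.log x))
      ∧ x⁻¹ ≤ Real.exp (max 0 (-Real.log x)) := by
    intro x hx
    refine ⟨Real.one_le_exp (le_max_left _ _), ?_⟩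
    rw [← Real.exp_log (inv_pos.2 hx), Real.log_inv]
    exact Real.exp_le_exp.2 (le_max_right _ _)
  obtain ⟨hs1, hs2⟩ := hexp s hs
  obtain ⟨ht1, ht2⟩ := hexp t ht
  set Ls := max 0 (-Real.log s)
  set Lt := max 0 (-Real.log t)
  have hX : (combineSeries p)⁻¹ ≤ Real.exp Ls * Real.exp Lt * (y + 4) := by
    have hst : s⁻¹ * t⁻¹ ≤ Real.exp Ls * Real.exp Lt :=
      mul_le_mul hs2 ht2 (by positivity) (by positivity)
    have hs3 : s⁻¹ ≤ Real.exp Ls * Real.exp Lt := by nlinarith [inv_pos.2 hs]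
    have ht3 : t⁻¹ ≤ Real.exp Ls * Real.exp Lt := by nlinarith [inv_pos.2 ht]
    have e1 : (combineSeries p)⁻¹ = b * (s⁻¹ * t⁻¹) := by
      rw [show combineSeries p = s * t / b from rfl]
      field_simp
    have e2 : (y + 2 * (s + t)) * (s⁻¹ * t⁻¹) = y * (s⁻¹ * t⁻¹) + 2 * s⁻¹ + 2 * t⁻¹ := by
      field_simp
      ring
    have e3 : b * (s⁻¹ * t⁻¹) ≤ (y + 2 * (s + t)) * (s⁻¹ * t⁻¹) :=
      mul_le_mul_of_nonneg_right hb1 (by positivity)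
    have e4 := mul_le_mul_of_nonneg_left hst hy
    rw [e1]
    linarith
  have hX0 : 0 < combineSeries p := combineSeries_pos ⟨⟨hs, ht⟩, hb⟩
  rw [← Real.log_inv]
  refine (Real.log_le_log (inv_pos.2 hX0) hX).trans ?_
  rw [Real.log_mul (by positivity) (by positivity), Real.log_mul (by positivity) (by positivity),
    Real.log_exp, Real.log_exp]
  have := Real.log_le_sub_one_of_pos (x := y + 4) (by linarith)
  linarith

theorem posExp_neg_log_combineSeries_ne_top (hν : ∀ᵐ t ∂ν, 0 < t)
    (h : posExp ν (fun t => -Real.log t) ≠ ∞) :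
    posExp (pivotLaw ν) (fun p => -Real.log (combineSeries p)) ≠ ∞ := by
  have := isProbabilityMeasure_pivotLaw hν
  have hle : posExp (pivotLaw ν) (fun p => -Real.log (combineSeries p))
      ≤ ∫⁻ p, ((ENNReal.ofReal (-Real.log p.1.1) + ENNReal.ofReal (-Real.log p.1.2))
        + (ENNReal.ofReal (2 * p.2 + (p.1.1 + p.1.2) ^ 2 / (2 * p.2) - 2 * (p.1.1 + p.1.2))
          + 3)) ∂pivotLaw ν := by
    refine lintegral_mono_ae ?_
    filter_upwards [ae_pivotLaw_pos hν] with p hp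
    refine (ENNReal.ofReal_le_ofReal (neg_log_combineSeries_le hp)).trans ?_
    refine ENNReal.ofReal_add_le.trans (add_le_add ?_ ?_)
    · refine ENNReal.ofReal_add_le.trans (add_le_add ?_ ?_) <;>
        simp [ENNReal.ofReal_max]
    · refine ENNReal.ofReal_add_le.trans (add_le_add le_rfl ?_)
      simp
  rw [lintegral_add_left (by fun_prop), lintegral_add_left (by fun_prop),
    lintegral_add_left (by fun_prop), lintegral_pivotLaw_sq hν,
    (measurePreserving_pivotLaw_fst_fst hν).lintegral_comp
      (f := fun t => ENNReal.ofReal (-Real.log t)) (by fun_prop),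
    (measurePreserving_pivotLaw_fst_snd hν).lintegral_comp
      (f := fun t => ENNReal.ofReal (-Real.log t)) (by fun_prop), lintegral_const,
    measure_univ, mul_one] at hle
  refine ne_top_of_le_ne_top ?_ hle
  exact ENNReal.add_ne_top.2 ⟨ENNReal.add_ne_top.2 ⟨h, h⟩, by simp⟩

/-- The first logarithmic bound, by comparison of harmonic and geometric mean. -/
theorem integral_log_combineSeries_le (hν : ∀ᵐ t ∂ν, 0 < t) (hint : Integrable Real.log ν)
    (hintX : Integrable (fun p => Real.log (combineSeries p)) (pivotLaw ν)) :
    ∫ p, Real.log (combineSeries p) ∂pivotLaw ν ≤ ∫ t, Real.log t ∂ν - Real.log 2 := by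
  have := isProbabilityMeasure_pivotLaw hν
  have hf := measurePreserving_pivotLaw_fst_fst hν
  have hs := measurePreserving_pivotLaw_fst_snd hν
  have i1 : Integrable (fun p : (ℝ × ℝ) × ℝ => Real.log p.1.1) (pivotLaw ν) :=
    (hf.integrable_comp hint.aestronglyMeasurable).2 hint
  have i2 : Integrable (fun p : (ℝ × ℝ) × ℝ => Real.log p.1.2) (pivotLaw ν) :=
    (hs.integrable_comp hint.aestronglyMeasurable).2 hint
  have hm : Measurable fun p : (ℝ × ℝ) × ℝ => (p.1.1 + p.1.2) / (2 * p.2) := by fun_prop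
  have hae : 0 ≤ᵐ[pivotLaw ν] fun p : (ℝ × ℝ) × ℝ => (p.1.1 + p.1.2) / (2 * p.2) := by
    filter_upwards [ae_pivotLaw_pos hν] with p hp
    exact (div_pos (add_pos hp.1.1 hp.1.2) hp.2).le
  have i3 : Integrable (fun p : (ℝ × ℝ) × ℝ => (p.1.1 + p.1.2) / (2 * p.2)) (pivotLaw ν) := by
    refine (lintegral_ofReal_ne_top_iff_integrable hm.aestronglyMeasurable hae).1 ?_
    rw [lintegral_pivotLaw_div hν]
    exact ENNReal.one_ne_top
  have e3 : ∫ p, (p.1.1 + p.1.2) / (2 * p.2) ∂pivotLaw ν = 1 := by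
    rw [integral_eq_lintegral_of_nonneg_ae hae hm.aestronglyMeasurable, lintegral_pivotLaw_div hν]
    simp
  have e1 : ∫ p, Real.log p.1.1 ∂pivotLaw ν = ∫ t, Real.log t ∂ν := by
    have := integral_map (f := Real.log) hf.aemeasurable
      Real.measurable_log.aestronglyMeasurable
    rw [hf.map_eq] at this
    exact this.symm
  have e2 : ∫ p, Real.log p.1.2 ∂pivotLaw ν = ∫ t, Real.log t ∂ν := by
    have := integral_map (f := Real.log) hs.aemeasurable
      Real.measurable_log.aestronglyMeasurable
    rw [hs.map_eq] at this
    exact this.symm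
  have j1 : Integrable (fun p : (ℝ × ℝ) × ℝ => 2⁻¹ * Real.log p.1.1 + 2⁻¹ * Real.log p.1.2)
      (pivotLaw ν) := (i1.const_mul _).add (i2.const_mul _)
  have j2 : Integrable (fun p : (ℝ × ℝ) × ℝ => (p.1.1 + p.1.2) / (2 * p.2) - (1 + Real.log 2))
      (pivotLaw ν) := i3.sub (integrable_const _)
  calc ∫ p, Real.log (combineSeries p) ∂pivotLaw ν
      ≤ ∫ p, ((2⁻¹ * Real.log p.1.1 + 2⁻¹ * Real.log p.1.2) + ((p.1.1 + p.1.2) / (2 * p.2)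
          - (1 + Real.log 2))) ∂pivotLaw ν := by
        refine integral_mono_ae hintX (j1.add j2) ?_
        filter_upwards [ae_pivotLaw_pos hν] with p hp
        have h1 := log_combineSeries_le hp
        obtain ⟨⟨hs, ht⟩, hb⟩ := hp
        have h2 : 2 * Real.log (p.1.1 * p.1.2 / (p.1.1 + p.1.2))
            ≤ Real.log p.1.1 + Real.log p.1.2 - 2 * Real.log 2 := by
          rw [← Real.log_mul hs.ne' ht.ne', ← Real.log_rpow two_pos,
            ← Real.log_rpow (by positivity), ← Real.log_div (by positivity) (by positivity)]
          refine Real.log_le_log (by positivity) ?_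
          rw [Real.rpow_two, Real.rpow_two, div_pow,
            div_le_div_iff₀ (by positivity) (by positivity)]
          nlinarith [mul_nonneg (mul_pos hs ht).le (sq_nonneg (p.1.1 - p.1.2))]
        linarith
    _ = ∫ t, Real.log t ∂ν - Real.log 2 := by
        rw [integral_add j1 j2,
          integral_add (i1.const_mul _) (i2.const_mul _), integral_sub i3 (integrable_const _),
          integral_const_mul, integral_const_mul, e1, e2, e3]
        simp
        ring

/-- The bound with `log x` replaced by its upper approximation `(x ^ α - 1) / α`, to which the
moment bound applies. -/
theorem integral_log_combineSeries_le_rpow (hν : ∀ᵐ t ∂ν, 0 < t) (hint : Integrable Real.log ν)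
    (hintX : Integrable (fun p => Real.log (combineSeries p)) (pivotLaw ν)) {α : ℝ}
    (hα0 : 0 < α) (hα : α < 1 / 2) :
    ∫ p, Real.log (combineSeries p) ∂pivotLaw ν
      ≤ 2 * ∫ t, Real.log t ∂ν + α⁻¹ * (cAlpha α - 1) := by
  have := isProbabilityMeasure_pivotLaw hν
  have hf := measurePreserving_pivotLaw_fst_fst hν
  have hs := measurePreserving_pivotLaw_fst_snd hν
  have i1 : Integrable (fun p : (ℝ × ℝ) × ℝ => Real.log p.1.1) (pivotLaw ν) :=
    (hf.integrable_comp hint.aestronglyMeasurable).2 hint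
  have i2 : Integrable (fun p : (ℝ × ℝ) × ℝ => Real.log p.1.2) (pivotLaw ν) :=
    (hs.integrable_comp hint.aestronglyMeasurable).2 hint
  have hm : Measurable fun p : (ℝ × ℝ) × ℝ => (2 * p.2) ^ (-α) := by fun_prop
  have hae : 0 ≤ᵐ[pivotLaw ν] fun p : (ℝ × ℝ) × ℝ => (2 * p.2) ^ (-α) := by
    filter_upwards [ae_pivotLaw_pos hν] with p hp
    exact Real.rpow_nonneg hp.2.le _
  have hle : ∫⁻ p, ENNReal.ofReal ((2 * p.2) ^ (-α)) ∂pivotLaw ν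
      ≤ ENNReal.ofReal (cAlpha α) := by
    have h := lintegral_pivotLaw_mul_rpow_le hν (F := fun _ => 1) measurable_const hα0.le hα
    simpa using h
  have i3 : Integrable (fun p : (ℝ × ℝ) × ℝ => (2 * p.2) ^ (-α)) (pivotLaw ν) :=
    (lintegral_ofReal_ne_top_iff_integrable hm.aestronglyMeasurable hae).1
      (ne_top_of_le_ne_top ENNReal.ofReal_ne_top hle)
  have e3 : ∫ p, (2 * p.2) ^ (-α) ∂pivotLaw ν ≤ cAlpha α := by
    rw [integral_eq_lintegral_of_nonneg_ae hae hm.aestronglyMeasurable]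
    exact ENNReal.toReal_le_of_le_ofReal (cAlpha_pos hα).le hle
  have e1 : ∫ p, Real.log p.1.1 ∂pivotLaw ν = ∫ t, Real.log t ∂ν := by
    have := integral_map (f := Real.log) hf.aemeasurable
      Real.measurable_log.aestronglyMeasurable
    rw [hf.map_eq] at this
    exact this.symm
  have e2 : ∫ p, Real.log p.1.2 ∂pivotLaw ν = ∫ t, Real.log t ∂ν := by
    have := integral_map (f := Real.log) hs.aemeasurable
      Real.measurable_log.aestronglyMeasurable
    rw [hs.map_eq] at this
    exact this.symm
  have j1 : Integrable (fun p : (ℝ × ℝ) × ℝ => Real.log p.1.1 + Real.log p.1.2) (pivotLaw ν) :=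
    i1.add i2
  have j2 : Integrable (fun p : (ℝ × ℝ) × ℝ => α⁻¹ * ((2 * p.2) ^ (-α) - 1)) (pivotLaw ν) :=
    (i3.sub (integrable_const _)).const_mul _
  calc ∫ p, Real.log (combineSeries p) ∂pivotLaw ν
      ≤ ∫ p, ((Real.log p.1.1 + Real.log p.1.2) + α⁻¹ * ((2 * p.2) ^ (-α) - 1)) ∂pivotLaw ν := by
        refine integral_mono_ae hintX (j1.add j2) ?_
        filter_upwards [ae_pivotLaw_pos hν] with p hp
        obtain ⟨⟨hs, ht⟩, hb⟩ := hp
        have h1 : Real.log (combineSeries p)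
            = Real.log p.1.1 + Real.log p.1.2 - Real.log (2 * p.2) := by
          rw [combineSeries, Real.log_div (by positivity) hb.ne', Real.log_mul hs.ne' ht.ne']
        have h2 := Real.log_le_sub_one_of_pos (Real.rpow_pos_of_pos hb (-α))
        rw [Real.log_rpow hb] at h2
        have h3 : -Real.log (2 * p.2) ≤ α⁻¹ * ((2 * p.2) ^ (-α) - 1) := by
          rw [← div_eq_inv_mul, le_div_iff₀ hα0]
          linarith
        linarith
    _ = 2 * ∫ t, Real.log t ∂ν + α⁻¹ * (∫ p, (2 * p.2) ^ (-α) ∂pivotLaw ν - 1) := by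
        rw [integral_add j1 j2,
          integral_add i1 i2, integral_const_mul, integral_sub i3 (integrable_const _), e1, e2]
        simp
        ring
    _ ≤ _ := by
        have := mul_le_mul_of_nonneg_left (sub_le_sub_right e3 1) (inv_pos.2 hα0).le
        linarith

/-- The second logarithmic bound, from `integral_log_combineSeries_le_rpow` as `α → 0`. -/
theorem integral_log_combineSeries_le_two_mul (hν : ∀ᵐ t ∂ν, 0 < t)
    (hint : Integrable Real.log ν)
    (hintX : Integrable (fun p => Real.log (combineSeries p)) (pivotLaw ν)) :
    ∫ p, Real.log (combineSeries p) ∂pivotLaw ν ≤ 2 * ∫ t, Real.log t ∂ν + cTwo := by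
  have hlim : Filter.Tendsto (fun α : ℝ => 2 * ∫ t, Real.log t ∂ν + α⁻¹ * (cAlpha α - 1))
      (nhdsWithin 0 (Set.Ioi 0)) (nhds (2 * ∫ t, Real.log t ∂ν + cTwo)) := by
    have h := (hasDerivAt_iff_tendsto_slope_zero.1 hasDerivAt_cAlpha_zero).mono_left
      (nhdsWithin_mono 0 fun x hx => (ne_of_gt hx : x ≠ 0))
    simp only [zero_add, smul_eq_mul, cAlpha_zero] at h
    exact h.const_add _
  refine ge_of_tendsto hlim ?_
  filter_upwards [Ioo_mem_nhdsGT (show (0 : ℝ) < 1 / 2 by norm_num)] with α hα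
  exact integral_log_combineSeries_le_rpow hν hint hintX hα.1 hα.2

/-- The logarithmic bounds in `[-∞, ∞]`. If the expectation is `∞`, the bound is void; if it is
`-∞`, so is that of the reduced weight; otherwise both logarithms are integrable. -/
theorem extExp_log_combineSeries_le (hν : ∀ᵐ t ∂ν, 0 < t) (h : HasExtExp ν Real.log) :
    HasExtExp (pivotLaw ν) (fun p => Real.log (combineSeries p)) ∧
      extExp (pivotLaw ν) (fun p => Real.log (combineSeries p))
        ≤ min (extExp ν Real.log - ((Real.log 2 : ℝ) : EReal))
            (2 * extExp ν Real.log + ((cTwo : ℝ) : EReal)) := by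
  by_cases hp : posExp ν Real.log = ∞
  · have hn : posExp ν (fun t => -Real.log t) ≠ ∞ := h.resolve_left (not_not.2 hp)
    refine ⟨Or.inr (posExp_neg_log_combineSeries_ne_top hν hn), ?_⟩
    have htop : extExp ν Real.log = ⊤ := by
      unfold extExp
      rw [hp, ← EReal.coe_ennreal_toReal hn, EReal.coe_ennreal_top, EReal.top_sub_coe]
    rw [htop, EReal.top_sub_coe, EReal.mul_top_of_pos (by norm_num), EReal.top_add_coe, min_self]
    exact le_top
  · have hpX := posExp_log_combineSeries_ne_top hν hp
    refine ⟨Or.inl hpX, ?_⟩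
    by_cases hn : posExp ν (fun t => -Real.log t) = ∞
    · have hnX := posExp_neg_log_combineSeries_eq_top hν hn
      have hbot : extExp (pivotLaw ν) (fun p => Real.log (combineSeries p)) = ⊥ := by
        unfold extExp
        rw [hnX, ← EReal.coe_ennreal_toReal hpX, EReal.coe_ennreal_top, sub_eq_add_neg,
          EReal.neg_top, EReal.add_bot]
      rw [hbot]
      exact bot_le
    · have hnX := posExp_neg_log_combineSeries_ne_top hν hn
      have hint := integrable_of_posExp Real.measurable_log hp hn
      have hintX := integrable_of_posExp measurable_log_combineSeries hpX hnX
      rw [extExp_eq_integral Real.measurable_log hp hn,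
        extExp_eq_integral measurable_log_combineSeries hpX hnX, le_min_iff]
      refine ⟨?_, ?_⟩
      · rw [← EReal.coe_sub, EReal.coe_le_coe_iff]
        exact integral_log_combineSeries_le hν hint hintX
      · rw [show (2 : EReal) = ((2 : ℝ) : EReal) from rfl, ← EReal.coe_mul, ← EReal.coe_add,
          EReal.coe_le_coe_iff]
        exact integral_log_combineSeries_le_two_mul hν hint hintX

end Logarithm

/-! ### Comparison of the bounds and passage to the effective weights -/

theorem ofReal_mul_lt_ofReal_mul_sq_iff {c C : ℝ} (hc : 0 < c) (hC : 0 < C) {M : ℝ≥0∞}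
    (hM : M ≠ ∞) :
    ENNReal.ofReal c * M < ENNReal.ofReal C * M ^ 2 ↔ ENNReal.ofReal (c * C⁻¹) < M := by
  obtain ⟨m, hm, rfl⟩ : ∃ m : ℝ, 0 ≤ m ∧ M = ENNReal.ofReal m :=
    ⟨M.toReal, ENNReal.toReal_nonneg, (ENNReal.ofReal_toReal hM).symm⟩
  rw [← ENNReal.ofReal_pow hm, ← ENNReal.ofReal_mul hc.le, ← ENNReal.ofReal_mul hC.le,
    ENNReal.ofReal_lt_ofReal_iff_of_nonneg (by positivity),
    ENNReal.ofReal_lt_ofReal_iff_of_nonneg (by positivity), ← div_eq_mul_inv, div_lt_iff₀ hC]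
  rcases hm.eq_or_lt with rfl | hm
  · simp [hc.le]
  · rw [sq, ← mul_assoc, mul_lt_mul_iff_left₀ hm, mul_comm C]

theorem min_sub_coe_two_mul_add_coe_eq_left_iff {x : EReal} (hx : x ≠ ⊥) (c d : ℝ) :
    min (x - (c : EReal)) (2 * x + (d : EReal)) = x - (c : EReal)
      ↔ ((-c - d : ℝ) : EReal) ≤ x := by
  rw [min_eq_left_iff]
  induction x with
  | bot => exact absurd rfl hx
  | top => simp [EReal.mul_top_of_pos]
  | coe x =>
    rw [show (2 : EReal) = ((2 : ℝ) : EReal) from rfl, ← EReal.coe_mul, ← EReal.coe_add,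
      ← EReal.coe_sub, EReal.coe_le_coe_iff, EReal.coe_le_coe_iff]
    constructor <;> intro h <;> linarith

section Law

variable {Ω S : Type*} [MeasurableSpace Ω] [MeasurableSpace S] {P : Measure Ω} {μ : Measure S}
  {X : Ω → S} {Z : Ω → ℝ} {f : S → ℝ}

theorem posExp_rpow_eq_of_map (hX : Measurable X) (hμ : P.map X = μ) (hf : Measurable f)
    (hZ : ∀ᵐ ω ∂P, Z ω = f (X ω)) (α : ℝ) :
    posExp P (fun ω => Z ω ^ α) = posExp μ (fun x => f x ^ α) :=
  posExp_eq_of_map hX hμ (hf.pow_const α) (hZ.mono fun ω h => by rw [h])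

theorem posExp_log_eq_of_map (hX : Measurable X) (hμ : P.map X = μ) (hf : Measurable f)
    (hZ : ∀ᵐ ω ∂P, Z ω = f (X ω)) :
    posExp P (fun ω => Real.log (Z ω)) = posExp μ (fun x => Real.log (f x)) :=
  posExp_eq_of_map hX hμ hf.log (hZ.mono fun ω h => by rw [h])

theorem posExp_neg_log_eq_of_map (hX : Measurable X) (hμ : P.map X = μ) (hf : Measurable f)
    (hZ : ∀ᵐ ω ∂P, Z ω = f (X ω)) :
    posExp P (fun ω => -Real.log (Z ω)) = posExp μ (fun x => -Real.log (f x)) :=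
  posExp_eq_of_map hX hμ hf.log.neg (hZ.mono fun ω h => by rw [h])

theorem hasExtExp_log_iff_of_map (hX : Measurable X) (hμ : P.map X = μ) (hf : Measurable f)
    (hZ : ∀ᵐ ω ∂P, Z ω = f (X ω)) :
    HasExtExp P (fun ω => Real.log (Z ω)) ↔ HasExtExp μ (fun x => Real.log (f x)) := by
  unfold HasExtExp
  rw [posExp_log_eq_of_map hX hμ hf hZ, posExp_neg_log_eq_of_map hX hμ hf hZ]

theorem extExp_log_eq_of_map (hX : Measurable X) (hμ : P.map X = μ) (hf : Measurable f)
    (hZ : ∀ᵐ ω ∂P, Z ω = f (X ω)) :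
    extExp P (fun ω => Real.log (Z ω)) = extExp μ (fun x => Real.log (f x)) := by
  unfold extExp
  rw [posExp_log_eq_of_map hX hμ hf hZ, posExp_neg_log_eq_of_map hX hμ hf hZ]

theorem ae_pos_of_map (hX : Measurable X) (hμ : P.map X = μ) (hpos : ∀ᵐ x ∂μ, 0 < f x)
    (hZ : ∀ᵐ ω ∂P, Z ω = f (X ω)) : ∀ᵐ ω ∂P, 0 < Z ω := by
  subst hμ
  filter_upwards [ae_of_ae_map hX.aemeasurable hpos, hZ] with ω h1 h2
  rwa [h2]

end Law

/-- The common law of identically distributed, positive, independent weights. An empty family is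
given the Dirac mass at `1`. -/
theorem exists_common_law {ι Ω : Type*} [Fintype ι] [MeasurableSpace Ω] {P : Measure Ω}
    [IsProbabilityMeasure P] {W : ι → Ω → ℝ} (hWm : ∀ a, Measurable (W a))
    (hWpos : ∀ a, ∀ᵐ ω ∂P, 0 < W a ω) (hWindep : iIndepFun W P)
    (hWident : ∀ a b, IdentDistrib (W a) (W b) P P) :
    ∃ ν : Measure ℝ, IsProbabilityMeasure ν ∧ (∀ᵐ t ∂ν, 0 < t) ∧
      P.map (fun ω a => W a ω) = Measure.pi fun _ => ν := by
  obtain ⟨ν, hν1, hν2, hν⟩ : ∃ ν : Measure ℝ, IsProbabilityMeasure ν ∧ (∀ᵐ t ∂ν, 0 < t) ∧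
      ∀ a, P.map (W a) = ν := by
    rcases isEmpty_or_nonempty ι with hι | ⟨⟨a⟩⟩
    · exact ⟨Measure.dirac 1, inferInstance, by simp [ae_dirac_eq], fun a => hι.elim a⟩
    · refine ⟨P.map (W a), Measure.isProbabilityMeasure_map (hWm a).aemeasurable, ?_,
        fun b => (hWident b a).map_eq⟩
      exact (ae_map_iff (hWm a).aemeasurable measurableSet_Ioi).2 (hWpos a)
  refine ⟨ν, hν1, hν2, ?_⟩
  rw [(iIndepFun_iff_map_fun_eq_pi_map fun a => (hWm a).aemeasurable).1 hWindep]
  simp only [hν]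

theorem mainTheorem5 {V : Type*} [Fintype V] [DecidableEq V]
    (G : SimpleGraph V) [DecidableRel G.Adj]
    (dir : G.edgeSet → G.Dart) (hdir : ∀ e, (dir e).edge = e)
    {Ω : Type*} [MeasurableSpace Ω] (P : Measure Ω) [IsProbabilityMeasure P]
    (r l : ℕ) (hl : 1 ≤ l) (hlr : l ≤ r)
    (W : SubdivEdge G r → Ω → ℝ) (hWm : ∀ a, Measurable (W a))
    (hWpos : ∀ a, ∀ᵐ ω ∂P, 0 < W a ω)
    (hWindep : iIndepFun W P)
    (hWident : ∀ a b, IdentDistrib (W a) (W b) P P)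
    (β : Ω → SubdivVertex G r → ℝ) (hβm : Measurable β)
    (hβ : IsCondLaw P β (fun ω a => W a ω) (fun w => betaLaw (weightMatrix dir r w)))
    -- `U` is the family `W^{(l-1)}` and `T` is the family `W^{(l)}`
    (U : SubdivEdge G (l - 1) → Ω → ℝ)
    (hU : ∀ a ω, U a ω =
      effEdgeWeight dir ((Nat.sub_le l 1).trans hlr) (fun b => W b ω) (β ω) a)
    (T : SubdivEdge G l → Ω → ℝ)
    (hT : ∀ a ω, T a ω = effEdgeWeight dir hlr (fun b => W b ω) (β ω) a) :
    -- the effective weights are positive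
    (∀ a, ∀ᵐ ω ∂P, 0 < U a ω) ∧ (∀ a, ∀ᵐ ω ∂P, 0 < T a ω) ∧
    -- the expectations do not depend on the choice of the edge
    (∀ a b, ∀ α : ℝ, 0 ≤ α → α ≤ 1 →
      posExp P (fun ω => U a ω ^ α) = posExp P (fun ω => U b ω ^ α)) ∧
    (∀ a b, ∀ α : ℝ, 0 ≤ α → α ≤ 1 →
      posExp P (fun ω => T a ω ^ α) = posExp P (fun ω => T b ω ^ α)) ∧
    (∀ a b, (HasExtExp P (fun ω => Real.log (U a ω)) ↔ HasExtExp P (fun ω => Real.log (U b ω))) ∧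
      extExp P (fun ω => Real.log (U a ω)) = extExp P (fun ω => Real.log (U b ω))) ∧
    (∀ a b, (HasExtExp P (fun ω => Real.log (T a ω)) ↔ HasExtExp P (fun ω => Real.log (T b ω))) ∧
      extExp P (fun ω => Real.log (T a ω)) = extExp P (fun ω => Real.log (T b ω))) ∧
    ∀ (a : SubdivEdge G (l - 1)) (b : SubdivEdge G l),
      -- first bound
      (∀ α : ℝ, 0 ≤ α → α ≤ 1 →
        posExp P (fun ω => U a ω ^ α)
          ≤ ENNReal.ofReal (2 ^ (-α)) * posExp P (fun ω => T b ω ^ α)) ∧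
      -- second bound
      (∀ α : ℝ, 0 ≤ α → α < 1 / 2 →
        posExp P (fun ω => U a ω ^ α)
          ≤ ENNReal.ofReal (cAlpha α) * posExp P (fun ω => T b ω ^ α) ^ 2) ∧
      -- the first bound is stronger than the second one exactly for large moments
      (∀ α : ℝ, 0 ≤ α → α < 1 / 2 → posExp P (fun ω => T b ω ^ α) ≠ ∞ →
        (ENNReal.ofReal (2 ^ (-α)) * posExp P (fun ω => T b ω ^ α)
            < ENNReal.ofReal (cAlpha α) * posExp P (fun ω => T b ω ^ α) ^ 2
          ↔ ENNReal.ofReal (2 ^ (-α) * (cAlpha α)⁻¹) < posExp P (fun ω => T b ω ^ α))) ∧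
      -- the logarithmic bound
      (HasExtExp P (fun ω => Real.log (T b ω)) →
        HasExtExp P (fun ω => Real.log (U a ω)) ∧
        extExp P (fun ω => Real.log (U a ω))
          ≤ min (extExp P (fun ω => Real.log (T b ω)) - ((Real.log 2 : ℝ) : EReal))
              (2 * extExp P (fun ω => Real.log (T b ω)) + ((cTwo : ℝ) : EReal)) ∧
        (extExp P (fun ω => Real.log (T b ω)) ≠ ⊥ →
          (min (extExp P (fun ω => Real.log (T b ω)) - ((Real.log 2 : ℝ) : EReal))
              (2 * extExp P (fun ω => Real.log (T b ω)) + ((cTwo : ℝ) : EReal))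
            = extExp P (fun ω => Real.log (T b ω)) - ((Real.log 2 : ℝ) : EReal)
          ↔ ((-Real.log 2 - cTwo : ℝ) : EReal) ≤ extExp P (fun ω => Real.log (T b ω))))) := by
  obtain ⟨ν₀, hν₀1, hν₀2, hWν⟩ := exists_common_law hWm hWpos hWindep hWident
  obtain ⟨m, rfl⟩ : ∃ m, l = m + 1 := ⟨l - 1, by omega⟩
  obtain ⟨ν, hν1, hν, hTν, hUν⟩ := exists_pivot_data dir hdir ((Nat.sub_le (m + 1) 1).trans hlr) hlr
    (measurable_pi_lambda _ hWm) hβm hβ hν₀2 hWν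
  choose X hXm hXν hX using hTν
  choose Y hYm hYν hY using hUν
  replace hX : ∀ b, ∀ᵐ ω ∂P, T b ω = (fun t => t) (X b ω) := fun b =>
    (hX b).mono fun ω h => (hT b ω).trans h
  replace hY : ∀ a, ∀ᵐ ω ∂P, U a ω = combineSeries (Y a ω) := fun a =>
    (hY a).mono fun ω h => (hU a ω).trans h
  have hTmom := fun b => posExp_rpow_eq_of_map (hXm b) (hXν b) measurable_id' (hX b)
  have hUmom := fun a => posExp_rpow_eq_of_map (hYm a) (hYν a) measurable_combineSeries (hY a)
  have hThas := fun b => hasExtExp_log_iff_of_map (hXm b) (hXν b) measurable_id' (hX b)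
  have hUhas := fun a =>
    hasExtExp_log_iff_of_map (hYm a) (hYν a) measurable_combineSeries (hY a)
  have hText := fun b => extExp_log_eq_of_map (hXm b) (hXν b) measurable_id' (hX b)
  have hUext := fun a => extExp_log_eq_of_map (hYm a) (hYν a) measurable_combineSeries (hY a)
  refine ⟨fun a => ae_pos_of_map (hYm a) (hYν a)
      ((ae_pivotLaw_pos hν).mono fun p => combineSeries_pos) (hY a),
    fun b => ae_pos_of_map (hXm b) (hXν b) hν (hX b),
    fun a b α _ _ => (hUmom a α).trans (hUmom b α).symm,
    fun a b α _ _ => (hTmom a α).trans (hTmom b α).symm,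
    fun a b => ⟨(hUhas a).trans (hUhas b).symm, (hUext a).trans (hUext b).symm⟩,
    fun a b => ⟨(hThas a).trans (hThas b).symm, (hText a).trans (hText b).symm⟩,
    fun a b => ⟨fun α h0 h1 => ?_, fun α h0 h1 => ?_, fun α _ h1 hM => ?_, fun h => ?_⟩⟩
  · rw [hUmom, hTmom]
    exact posExp_combineSeries_rpow_le hν h0 h1
  · rw [hUmom, hTmom]
    exact posExp_combineSeries_rpow_le_sq hν h0 h1
  · exact ofReal_mul_lt_ofReal_mul_sq_iff (by positivity) (cAlpha_pos h1) hM
  · obtain ⟨h1, h2⟩ := extExp_log_combineSeries_le hν ((hThas b).1 h)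
    refine ⟨(hUhas a).2 h1, ?_, fun hbot => min_sub_coe_two_mul_add_coe_eq_left_iff hbot _ _⟩
    rw [hUext, hText]
    exact h2

end
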